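/- Let $A\in\mathbb R^{m\times n}$ have rank $m$, let $b\in\mathbb R^m$, and let $K:=\{x\in\mathbb R^n_{\ge 0}: Ax=b\}$ be compact and contain a point with all coordinates strictly positive. Let $P_n(E):=H^{n-m}(E\cap K)/H^{n-m}(K)$ be the uniform distribution on $K$, where $H^{n-m}$ is the $(n-m)$-dimensional Hausdorff measure. For $w\in(0,\infty)^n$ let $P_{n,w}$ be the probability measure on $\mathbb R^n$ with density $\big(\prod_{j=1}^n w_j\big)e^{-\sum_{j=1}^n w_jx_j}\mathbf 1_{\mathbb R^n_{\ge0}}(x)$. Fix $w\in(0,\infty)^n$ such that either $P_{n,w}$ maximizes the (differential) entropy among all probability measures on $\mathbb R^n_{\ge 0}$ whose mean vector exists and lies in $K$ (and $P_{n,w}$ is itself such a measure), or $w$ lies in the row span of $A$. Let $A_{\bullet j}$ denote the $j$-th column of $A$. Assume that the rank of $A$ cannot be reduced by removing one column. Then the functions $$x\mapsto e^{-\sum_{j=1}^n(w_j-\mathrm i\langle\eta,A_{\bullet j}\rangle)x_j}\mathbf 1_{\mathbb R^n_{\ge0}}(x)\ \ (\eta\in\mathbb R^m),\qquad \eta\mapsto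 \mathbb E_{P_{n,w}}e^{\mathrm i\sum_{j=1}^n\langle\eta,A_{\bullet j}\rangle X_j-\mathrm i\langle\eta,b\rangle}$$ are Lebesgue integrable on $\mathbb R^n$ and on $\mathbb R^m$, respectively, and their integrals $$Z_{n,w,\eta}:=\int_{\mathbb R^n}e^{-\sum_{j=1}^n(w_j-\mathrm i\langle\eta,A_{\bullet j}\rangle)x_j}\mathbf 1_{\mathbb R^n_{\ge0}}(x)\,dx,\qquad Z_{n,\mathrm{mix}}:=\int_{\mathbb R^m}\mathbb E_{P_{n,w}}e^{\mathrm i\sum_{j=1}^n\langle\eta,A_{\bullet j}\rangle X_j-\mathrm i\langle\eta,b\rangle}\,d\eta$$ satisfy $0<|Z_{n,w,\eta}|<\infty$ for every $\eta\in\mathbb R^m$ and $0<|Z_{n,\mathrm{mix}}|<\infty$. Define the complex measures $P_{n,w,\eta}$ on $\mathbb R^n$ and $P_{n,\mathrm{mix}}$ on $\mathbb R^m$ by $$P_{n,w,\eta}(B):=\frac1{Z_{n,w,\eta}}\int_B e^{-\sum_{j=1}^n(w_j-\mathrm i\langle\eta,A_{\bullet j}\rangle)x_j}\mathbf 1_{\mathbb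 R^n_{\ge0}}(x)\,dx,\qquad dP_{n,\mathrm{mix}}(\eta):=\frac1{Z_{n,\mathrm{mix}}}\mathbb E_{P_{n,w}}e^{\mathrm i\sum_{j=1}^n\langle\eta,A_{\bullet j}\rangle X_j-\mathrm i\langle\eta,b\rangle}\,d\eta .$$ Then for every set $E=E_1\times\dots\times E_n$ with intervals $E_j\subset\mathbb R$ (of any kind, possibly unbounded or degenerate), the function $\eta\mapsto P_{n,w,\eta}(E)$ is integrable with respect to $P_{n,\mathrm{mix}}$ and $$P_n(E)=\int_{\mathbb R^m}P_{n,w,\eta}(E)\,dP_{n,\mathrm{mix}}(\eta).$$ -/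

import Mathlib

open MeasureTheory
open scoped ENNReal

noncomputable section

namespace Polytope

variable {m n : ℕ}

/-- The closed non-negative orthant of `ℝⁿ`. -/
def orthant (n : ℕ) : Set (EuclideanSpace ℝ (Fin n)) := {x | ∀ j, 0 ≤ x j}

/-- The polytope `K = {x ≥ 0 : A x = b}`. -/
def polytope (A : Matrix (Fin m) (Fin n) ℝ) (b : Fin m → ℝ) : Set (EuclideanSpace ℝ (Fin n)) :=
  {x | x ∈ orthant n ∧ A.mulVec x.ofLp = b}

/-- The uniform distribution on the polytope `K`: the `(n - m)`-dimensional Hausdorff measure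
restricted to `K` and divided by the Hausdorff measure of `K`. -/
def uniform (A : Matrix (Fin m) (Fin n) ℝ) (b : Fin m → ℝ) :
    Measure (EuclideanSpace ℝ (Fin n)) :=
  (Measure.hausdorffMeasure ((n : ℝ) - m) (polytope A b))⁻¹ •
    (Measure.hausdorffMeasure ((n : ℝ) - m)).restrict (polytope A b)

/-- The law on `ℝⁿ` with density `(∏ j, w j) * exp (- ∑ j, w j * x j)` on the orthant, i.e. of
independent exponential variables with rates `w j`. -/
def expProduct (w : Fin n → ℝ) : Measure (EuclideanSpace ℝ (Fin n)) :=
  (volume.restrict (orthant n)).withDensity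
    fun x => ENNReal.ofReal ((∏ j, w j) * Real.exp (-∑ j, w j * x j))

open Classical in
/-- The differential entropy of a measure on `ℝⁿ`: `-∫ f log f` if there is a density `f` for which
`f log f` is integrable, and `-∞` otherwise. -/
def entropy (Q : Measure (EuclideanSpace ℝ (Fin n))) : EReal :=
  if Q ≪ volume ∧
      Integrable (fun x => (Q.rnDeriv volume x).toReal * Real.log (Q.rnDeriv volume x).toReal) then
    ((-∫ x, (Q.rnDeriv volume x).toReal * Real.log (Q.rnDeriv volume x).toReal : ℝ) : EReal)
  else ⊥

/-- The probability measures on the orthant whose mean vector exists and lies in the polytope. -/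
def meanInPolytope (A : Matrix (Fin m) (Fin n) ℝ) (b : Fin m → ℝ) :
    Set (Measure (EuclideanSpace ℝ (Fin n))) :=
  {Q | IsProbabilityMeasure Q ∧ Q (orthant n)ᶜ = 0 ∧
    Integrable (fun x => x) Q ∧ ∫ x, x ∂Q ∈ polytope A b}

/-- `expProduct w` maximizes entropy among the probability measures on the orthant
whose mean vector lies in the polytope. -/
def IsMaxEntropy (A : Matrix (Fin m) (Fin n) ℝ) (b : Fin m → ℝ) (w : Fin n → ℝ) : Prop :=
  expProduct w ∈ meanInPolytope A b ∧
    ∀ Q ∈ meanInPolytope A b, entropy Q ≤ entropy (expProduct w)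

/-- The inner product `⟨η, A_{•j}⟩` of `η` with the `j`-th column of `A`. -/
def innerCol (A : Matrix (Fin m) (Fin n) ℝ) (η : EuclideanSpace ℝ (Fin m)) (j : Fin n) : ℝ :=
  ∑ l, η l * A l j

/-- The function `x ↦ exp (- ∑ j, (w j - i ⟨η, A_{•j}⟩) x j) 1_{x ≥ 0}`. -/
def complexDensity (A : Matrix (Fin m) (Fin n) ℝ) (w : Fin n → ℝ) (η : EuclideanSpace ℝ (Fin m)) :
    EuclideanSpace ℝ (Fin n) → ℂ :=
  (orthant n).indicator fun x =>
    Complex.exp (-∑ j, ((w j : ℂ) - Complex.I * (innerCol A η j : ℂ)) * (x j : ℂ))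

/-- The normalizing constant `Z_{n,w,η}`. -/
def complexZ (A : Matrix (Fin m) (Fin n) ℝ) (w : Fin n → ℝ) (η : EuclideanSpace ℝ (Fin m)) : ℂ :=
  ∫ x, complexDensity A w η x

/-- The complex measure `P_{n,w,η}` on `ℝⁿ`. -/
def complexProduct (A : Matrix (Fin m) (Fin n) ℝ) (w : Fin n → ℝ)
    (η : EuclideanSpace ℝ (Fin m)) : ComplexMeasure (EuclideanSpace ℝ (Fin n)) :=
  (complexZ A w η)⁻¹ • Measure.withDensityᵥ volume (complexDensity A w η)

/-- The function `η ↦ E exp (i ∑ j, ⟨η, A_{•j}⟩ X j - i ⟨η, b⟩)`, the expectation being with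
respect to `expProduct w`. -/
def mixDensity (A : Matrix (Fin m) (Fin n) ℝ) (b : Fin m → ℝ) (w : Fin n → ℝ)
    (η : EuclideanSpace ℝ (Fin m)) : ℂ :=
  ∫ x, Complex.exp (Complex.I * ∑ j, (innerCol A η j : ℂ) * (x j : ℂ) -
    Complex.I * ∑ l, (η l : ℂ) * (b l : ℂ)) ∂(expProduct w)

/-- The normalizing constant `Z_{n,mix}`. -/
def mixZ (A : Matrix (Fin m) (Fin n) ℝ) (b : Fin m → ℝ) (w : Fin n → ℝ) : ℂ :=
  ∫ η, mixDensity A b w η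

/-- The complex mixing measure `P_{n,mix}` on `ℝᵐ`. -/
def mixMeasure (A : Matrix (Fin m) (Fin n) ℝ) (b : Fin m → ℝ) (w : Fin n → ℝ) :
    ComplexMeasure (EuclideanSpace ℝ (Fin m)) :=
  (mixZ A b w)⁻¹ • Measure.withDensityᵥ volume (mixDensity A b w)

/-- The box `∏ j, E j`. -/
def box (E : Fin n → Set ℝ) : Set (EuclideanSpace ℝ (Fin n)) := {x | ∀ j, x j ∈ E j}

end Polytope

end

noncomputable section

namespace Polytope

variable {m n : ℕ}

/-! ### Integration against a complex measure with an integrable density -/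

section VectorMeasureIntegral

variable {X : Type*} [MeasurableSpace X] {μ : Measure X} {h : X → ℂ}

/-! The proof is Fourier inversion applied to the image of the exponential law under `A`.

If `w` lies in the row span, say `w j = ⟨l, A_{•j}⟩`, then `∑ w j * x j = ⟨l, A x⟩` is constant on
the fibers of `A`, so the exponential law is uniform on each fiber inside the orthant. Entropy
maximality reduces to this case (`IsMaxEntropy.mem_span_row`): the law with means `μ j` has entropy
`n + ∑ log (μ j)`, and stationarity along `ker A` makes `w` orthogonal to `ker A`.

For a box `E`, integrating the exponential weight over `E` and a fiber of `A` gives the function `y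
↦ exp(-⟨l, y⟩) * ν(E ∩ fiber over y)` (`fiberIntegral_eq`). Its Fourier transform is, up to a
constant and a dilation, the unnormalized mass `boxTransform` of `E` under the complex density.
Inversion at `y = b` gives `∫ exp(-i⟨η, b⟩) * boxTransform E η dη = C * ν(E ∩ K)` with `C ≠ 0`
independent of `E` (`integral_exp_mul_boxTransform`). Up to the factor `∏ w j`, this integrand is
`P_{n,w,η}(E)` times the mixing density. Dividing by the case of the full box gives the formula, and
all unknown constants cancel.

Inversion needs two facts, and both use the condition on deleting a column. The transform is
integrable: it is at most `2 ^ n * ∏ ‖rate j‖⁻¹`, and the smallest factor can be spread over `m`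
independent columns other than its own, raising their exponents above `1`
(`integrable_prod_norm_rate_inv`). The fiber integral is continuous at `b`: no coordinate is
constant on the fibers, so the faces of the box are null there and dominated convergence applies
(`continuousAt_fiberIntegral`). -/

theorem variation_withDensityᵥ_le (hh : Integrable h μ) :
    (μ.withDensityᵥ h).variation ≤ μ.withDensity fun x => ‖h x‖ₑ := by
  refine VectorMeasure.variation_le_of_forall_enorm_le fun E hE => ?_
  rw [withDensityᵥ_apply hh hE, withDensity_apply _ hE]
  exact enorm_integral_le_lintegral_enorm _

/-- Polar decomposition: the complex measure is the phase `u = h / ‖h‖` times the finite positive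
measure `σ = ‖h‖ μ`. Both sides are linear and `L¹(σ)`-Lipschitz in `f`, so indicators suffice. -/
theorem integral_withDensityᵥ_of_integrable_withDensity (hh : Integrable h μ) {f : X → ℂ}
    (hf : Integrable f (μ.withDensity fun x => ‖h x‖ₑ)) :
    (μ.withDensityᵥ h).integral f (ContinuousLinearMap.mul ℝ ℂ) = ∫ x, f x * h x ∂μ := by
  set σ : Measure X := μ.withDensity fun x => ‖h x‖ₑ with hσ
  have hle : (μ.withDensityᵥ h).variation ≤ σ := variation_withDensityᵥ_le hh
  have : IsFiniteMeasure σ := isFiniteMeasure_withDensity hh.2.ne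
  have hvf : IsFiniteMeasure (μ.withDensityᵥ h).variation := isFiniteMeasure_of_le _ hle
  set u : X → ℂ := fun x => h x / ‖h x‖ with hu
  have hum : AEStronglyMeasurable u σ := by
    refine AEStronglyMeasurable.mono_ac (withDensity_absolutelyContinuous _ _) ?_
    exact (hh.1.aemeasurable.div
      (Complex.measurable_ofReal.comp_aemeasurable hh.1.norm.aemeasurable)).aestronglyMeasurable
  have hub : ∀ x, ‖u x‖ ≤ 1 := fun x => by
    simp only [hu, norm_div, Complex.norm_real, norm_norm]
    exact div_self_le_one _
  have key : ∀ g : X → ℂ, ∫ x, g x * u x ∂σ = ∫ x, g x * h x ∂μ := fun g => by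
    rw [hσ]
    change ∫ x, g x * u x ∂(μ.withDensity fun x => ((‖h x‖₊ : NNReal) : ℝ≥0∞)) = _
    rw [integral_withDensity_eq_integral_smul₀ hh.1.nnnorm.aemeasurable]
    refine integral_congr_ae (Filter.Eventually.of_forall fun x => ?_)
    simp only [NNReal.smul_def, coe_nnnorm, Complex.real_smul, hu]
    by_cases hx : h x = 0
    -- Where `h` vanishes, `u` is `0` by the convention for division by zero.
    · simp [hx]
    · have : (‖h x‖ : ℂ) ≠ 0 := by simpa using hx
      field_simp
  have hint : ∀ g : X → ℂ, Integrable g σ → Integrable (fun x => g x * u x) σ := fun g hg =>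
    hg.mul_bdd hum (Filter.Eventually.of_forall hub)
  rw [← key]
  refine Integrable.induction (μ := σ)
    (fun f => (μ.withDensityᵥ h).integral f (ContinuousLinearMap.mul ℝ ℂ) = ∫ x, f x * u x ∂σ)
    ?_ ?_ ?_ ?_ hf
  · intro c s hs _
    rw [VectorMeasure.integral_indicator_const _ hs, withDensityᵥ_apply hh hs, key,
      ContinuousLinearMap.mul_apply', ← integral_const_mul, ← integral_indicator hs]
    refine integral_congr_ae (Filter.Eventually.of_forall fun x => ?_)
    by_cases hx : x ∈ s <;> simp [hx]
  · intro f g _ hf hg h1 h2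
    rw [VectorMeasure.integral_add (hf.mono_measure hle) (hg.mono_measure hle), h1, h2,
      ← integral_add (hint _ hf) (hint _ hg)]
    simp [add_mul]
  · refine isClosed_eq ?_ ?_
    · refine LipschitzWith.continuous (K := ‖ContinuousLinearMap.mul ℝ ℂ‖₊)
        (LipschitzWith.of_dist_le_mul fun f g => ?_)
      have hf := L1.integrable_coeFn f
      have hg := L1.integrable_coeFn g
      rw [dist_eq_norm, ← VectorMeasure.integral_sub (hf.mono_measure hle) (hg.mono_measure hle)]
      refine VectorMeasure.norm_integral_le_integral_norm.trans ?_
      rw [coe_nnnorm]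
      refine mul_le_mul_of_nonneg_left ?_ (ContinuousLinearMap.opNorm_nonneg _)
      rw [L1.dist_eq_integral_dist]
      simp_rw [dist_eq_norm]
      exact integral_mono_measure hle (Filter.Eventually.of_forall fun _ => norm_nonneg _)
        (hf.sub hg).norm
    · refine LipschitzWith.continuous (K := 1) (LipschitzWith.of_dist_le_mul fun f g => ?_)
      have hf := L1.integrable_coeFn f
      have hg := L1.integrable_coeFn g
      rw [dist_eq_norm, ← integral_sub (hint _ hf) (hint _ hg), L1.dist_eq_integral_dist,
        NNReal.coe_one, one_mul]
      refine (norm_integral_le_integral_norm _).trans ?_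
      refine integral_mono ((hint _ hf).sub (hint _ hg)).norm (by
        simp_rw [dist_eq_norm]; exact (hf.sub hg).norm) fun x => ?_
      dsimp only
      rw [← sub_mul, norm_mul, dist_eq_norm]
      exact mul_le_of_le_one_right (norm_nonneg _) (hub x)
  · intro f g hfg _ h1
    rw [← VectorMeasure.integral_congr_ae ((Measure.absolutelyContinuous_of_le hle).ae_eq hfg), h1]
    exact integral_congr_ae (hfg.mono fun x hx => by simp only [hx])

theorem integrable_and_integral_withDensityᵥ_of_bounded (hh : Integrable h μ) {f : X → ℂ}
    (hf : Measurable f) {C : ℝ} (hC : ∀ x, ‖f x‖ ≤ C) :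
    (μ.withDensityᵥ h).Integrable f ∧
    (μ.withDensityᵥ h).integral f (ContinuousLinearMap.mul ℝ ℂ) = ∫ x, f x * h x ∂μ := by
  have : IsFiniteMeasure (μ.withDensity fun x => ‖h x‖ₑ) := isFiniteMeasure_withDensity hh.2.ne
  have hfi : Integrable f (μ.withDensity fun x => ‖h x‖ₑ) :=
    Integrable.of_bound hf.aestronglyMeasurable C (Filter.Eventually.of_forall hC)
  exact ⟨hfi.mono_measure (variation_withDensityᵥ_le hh),
    integral_withDensityᵥ_of_integrable_withDensity hh hfi⟩

end VectorMeasureIntegral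

/-! ### Exponential integrals over intervals -/

section Interval

theorem integrableOn_cexp_neg_mul_Ici {z : ℂ} (hz : 0 < z.re) (a : ℝ) :
    IntegrableOn (fun x : ℝ => Complex.exp (-z * x)) (Set.Ici a) :=
  (integrableOn_Ici_iff_integrableOn_Ioi).2
    (integrableOn_exp_mul_complex_Ioi (a := -z) (by simpa using hz) a)

theorem norm_cexp_neg_mul_le_one {z : ℂ} (hz : 0 < z.re) {x : ℝ} (hx : 0 ≤ x) :
    ‖Complex.exp (-z * x)‖ ≤ 1 := by
  rw [Complex.norm_exp]
  simpa using mul_nonneg hz.le hx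

theorem integral_cexp_neg_mul_Ici {z : ℂ} (hz : 0 < z.re) :
    ∫ x in Set.Ici (0 : ℝ), Complex.exp (-z * x) = z⁻¹ := by
  rw [integral_Ici_eq_integral_Ioi, integral_exp_mul_complex_Ioi (a := -z) (by simpa using hz)]
  simp [neg_div_neg_eq]

/-- The primitive `-exp(-z x) / z` is at most `‖z‖⁻¹` on the half-line, and an interval has at most
two endpoints. Every interval thus has the same decay in `z` as the full half-line. -/
theorem norm_integral_cexp_neg_mul_le {z : ℂ} (hz : 0 < z.re) {S : Set ℝ} (hS : S.OrdConnected)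
    (hS0 : S ⊆ Set.Ici 0) : ‖∫ x in S, Complex.exp (-z * x)‖ ≤ 2 * ‖z‖⁻¹ := by
  have hz0 : z ≠ 0 := fun h => by simp [h] at hz
  have hIoc : ∀ a b : ℝ, 0 ≤ a → ‖∫ x in Set.Ioc a b, Complex.exp (-z * x)‖ ≤ 2 * ‖z‖⁻¹ := by
    intro a b ha
    rcases le_total b a with hba | hab
    · simp [Set.Ioc_eq_empty_of_le hba]
    rw [← intervalIntegral.integral_of_le hab, integral_exp_mul_complex (neg_ne_zero.2 hz0),
      norm_div, norm_neg, div_eq_mul_inv]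
    refine mul_le_mul_of_nonneg_right ?_ (by positivity)
    exact (norm_sub_le _ _).trans (by
      linarith [norm_cexp_neg_mul_le_one hz ha, norm_cexp_neg_mul_le_one hz (ha.trans hab)])
  have hIoi : ∀ a : ℝ, 0 ≤ a → ‖∫ x in Set.Ioi a, Complex.exp (-z * x)‖ ≤ 2 * ‖z‖⁻¹ := by
    intro a ha
    rw [integral_exp_mul_complex_Ioi (a := -z) (by simpa using hz), norm_div, norm_neg, norm_neg,
      div_eq_mul_inv]
    refine mul_le_mul_of_nonneg_right ?_ (by positivity)
    linarith [norm_cexp_neg_mul_le_one hz ha]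
  rcases S.eq_empty_or_nonempty with rfl | hne
  · simp
  have hbd : BddBelow S := ⟨0, fun x hx => hS0 hx⟩
  have ha : 0 ≤ sInf S := le_csInf hne fun x hx => hS0 hx
  -- Ten shapes of interval: those unbounded below cannot lie in the half-line, and the others
  -- differ from `Ioc` or `Ioi` by null sets.
  rcases hS.isPreconnected.mem_intervals with h | h | h | h | h | h | h | h | h | h
  · rw [h, integral_Icc_eq_integral_Ioc]; exact hIoc _ _ ha
  · rw [h, integral_Ico_eq_integral_Ioo, ← integral_Ioc_eq_integral_Ioo]; exact hIoc _ _ ha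
  · rw [h]; exact hIoc _ _ ha
  · rw [h, ← integral_Ioc_eq_integral_Ioo]; exact hIoc _ _ ha
  · rw [h, integral_Ici_eq_integral_Ioi]; exact hIoi _ ha
  · rw [h]; exact hIoi _ ha
  · exact (not_bddBelow_Iic _ (h ▸ hbd)).elim
  · exact (not_bddBelow_Iio _ (h ▸ hbd)).elim
  · exact (not_bddBelow_univ (h ▸ hbd)).elim
  · exact absurd hne (by rw [h]; exact Set.not_nonempty_empty)

end Interval

/-! ### Factorization of the complex density over coordinates -/

section Product

theorem measurableSet_box {E : Fin n → Set ℝ} (hE : ∀ j, MeasurableSet (E j)) :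
    MeasurableSet (box E) := by
  have : box E = ⋂ j, (fun x : EuclideanSpace ℝ (Fin n) => x j) ⁻¹' E j := by
    ext x; simp [box]
  rw [this]
  exact MeasurableSet.iInter fun j => (by fun_prop : Measurable _) (hE j)

theorem orthant_eq_box : orthant n = box fun _ => Set.Ici 0 := by
  ext x; simp [orthant, box]

theorem measurableSet_orthant : MeasurableSet (orthant n) := by
  rw [orthant_eq_box]
  exact measurableSet_box fun _ => measurableSet_Ici

theorem integrable_euclidean_prod {𝕜 : Type*} [RCLike 𝕜] {f : Fin n → ℝ → 𝕜}
    (hf : ∀ j, Integrable (f j)) :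
    Integrable fun x : EuclideanSpace ℝ (Fin n) => ∏ j, f j (x j) :=
  (PiLp.volume_preserving_ofLp (Fin n)).integrable_comp_of_integrable (Integrable.fintype_prod hf)

theorem integral_euclidean_prod {𝕜 : Type*} [RCLike 𝕜] (f : Fin n → ℝ → 𝕜) :
    ∫ x : EuclideanSpace ℝ (Fin n), ∏ j, f j (x j) = ∏ j, ∫ t, f j t := by
  rw [← integral_fintype_prod_volume_eq_prod]
  exact (PiLp.volume_preserving_ofLp (Fin n)).integral_comp
    (MeasurableEquiv.toLp 2 (Fin n → ℝ)).symm.measurableEmbedding fun x : Fin n → ℝ => ∏ j, f j (x j)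

theorem indicator_box_prod {𝕜 : Type*} [RCLike 𝕜] (E : Fin n → Set ℝ) (f : Fin n → ℝ → 𝕜)
    (x : EuclideanSpace ℝ (Fin n)) :
    (box E).indicator (fun x => ∏ j, f j (x j)) x = ∏ j, (E j).indicator (f j) (x j) := by
  by_cases hx : x ∈ box E
  · rw [Set.indicator_of_mem hx]
    exact Finset.prod_congr rfl fun j _ => (Set.indicator_of_mem (hx j) _).symm
  · rw [Set.indicator_of_notMem hx]
    obtain ⟨j, hj⟩ := not_forall.1 hx
    exact (Finset.prod_eq_zero (Finset.mem_univ j) (Set.indicator_of_notMem hj _)).symm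

/-- The complex rate `w j - i ⟨η, A_{•j}⟩`. -/
def rate (A : Matrix (Fin m) (Fin n) ℝ) (w : Fin n → ℝ) (η : EuclideanSpace ℝ (Fin m))
    (j : Fin n) : ℂ :=
  (w j : ℂ) - Complex.I * (innerCol A η j : ℂ)

theorem rate_re (A : Matrix (Fin m) (Fin n) ℝ) (w : Fin n → ℝ) (η : EuclideanSpace ℝ (Fin m))
    (j : Fin n) : (rate A w η j).re = w j := by simp [rate]

theorem rate_ne_zero (A : Matrix (Fin m) (Fin n) ℝ) {w : Fin n → ℝ} (hw : ∀ j, 0 < w j)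
    (η : EuclideanSpace ℝ (Fin m)) (j : Fin n) : rate A w η j ≠ 0 := fun h => by
  have := rate_re A w η j
  rw [h] at this
  exact (hw j).ne this

theorem complexDensity_eq_prod (A : Matrix (Fin m) (Fin n) ℝ) (w : Fin n → ℝ)
    (η : EuclideanSpace ℝ (Fin m)) (x : EuclideanSpace ℝ (Fin n)) :
    complexDensity A w η x =
      ∏ j, (Set.Ici 0).indicator (fun t : ℝ => Complex.exp (-rate A w η j * t)) (x j) := by
  rw [← indicator_box_prod, ← orthant_eq_box, complexDensity]
  congr 1
  ext x
  rw [← Complex.exp_sum, ← Finset.sum_neg_distrib]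
  simp only [rate, neg_mul]

theorem integrable_complexDensity (A : Matrix (Fin m) (Fin n) ℝ) {w : Fin n → ℝ}
    (hw : ∀ j, 0 < w j) (η : EuclideanSpace ℝ (Fin m)) : Integrable (complexDensity A w η) := by
  rw [funext (complexDensity_eq_prod A w η)]
  refine integrable_euclidean_prod fun j => ?_
  rw [integrable_indicator_iff measurableSet_Ici]
  exact integrableOn_cexp_neg_mul_Ici (by rw [rate_re]; exact hw j) 0

theorem setIntegral_box_complexDensity (A : Matrix (Fin m) (Fin n) ℝ) (w : Fin n → ℝ)
    (η : EuclideanSpace ℝ (Fin m)) {E : Fin n → Set ℝ} (hE : ∀ j, MeasurableSet (E j)) :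
    ∫ x in box E, complexDensity A w η x =
      ∏ j, ∫ t in E j ∩ Set.Ici 0, Complex.exp (-rate A w η j * t) := by
  rw [← integral_indicator (measurableSet_box hE)]
  simp_rw [funext (complexDensity_eq_prod A w η), indicator_box_prod, integral_euclidean_prod]
  refine Finset.prod_congr rfl fun j _ => ?_
  rw [Set.indicator_indicator, integral_indicator ((hE j).inter measurableSet_Ici)]

theorem box_univ : box (fun _ : Fin n => (Set.univ : Set ℝ)) = Set.univ := by
  ext; simp [box]

theorem complexZ_eq_prod (A : Matrix (Fin m) (Fin n) ℝ) {w : Fin n → ℝ} (hw : ∀ j, 0 < w j)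
    (η : EuclideanSpace ℝ (Fin m)) : complexZ A w η = ∏ j, (rate A w η j)⁻¹ := by
  have := setIntegral_box_complexDensity A w η (fun _ : Fin n => MeasurableSet.univ)
  rw [box_univ, setIntegral_univ] at this
  rw [complexZ, this]
  refine Finset.prod_congr rfl fun j _ => ?_
  rw [Set.univ_inter, integral_cexp_neg_mul_Ici (by rw [rate_re]; exact hw j)]

theorem complexZ_ne_zero (A : Matrix (Fin m) (Fin n) ℝ) {w : Fin n → ℝ} (hw : ∀ j, 0 < w j)
    (η : EuclideanSpace ℝ (Fin m)) : complexZ A w η ≠ 0 := by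
  rw [complexZ_eq_prod A hw]
  exact Finset.prod_ne_zero_iff.2 fun j _ => inv_ne_zero (rate_ne_zero A hw η j)

theorem norm_setIntegral_box_complexDensity_le (A : Matrix (Fin m) (Fin n) ℝ) {w : Fin n → ℝ}
    (hw : ∀ j, 0 < w j) (η : EuclideanSpace ℝ (Fin m)) {E : Fin n → Set ℝ}
    (hE : ∀ j, (E j).OrdConnected) :
    ‖∫ x in box E, complexDensity A w η x‖ ≤ 2 ^ n * ∏ j, ‖rate A w η j‖⁻¹ := by
  rw [setIntegral_box_complexDensity A w η fun j => (hE j).measurableSet, norm_prod]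
  refine (Finset.prod_le_prod (fun _ _ => norm_nonneg _) fun j _ =>
    norm_integral_cexp_neg_mul_le (by rw [rate_re]; exact hw j)
      ((hE j).inter Set.ordConnected_Ici) Set.inter_subset_right).trans ?_
  rw [Finset.prod_mul_distrib]
  simp

theorem withDensity_indicator_expProduct (w : Fin n → ℝ) :
    expProduct w = volume.withDensity ((orthant n).indicator fun x =>
      ENNReal.ofReal ((∏ j, w j) * Real.exp (-∑ j, w j * x j))) := by
  rw [expProduct, withDensity_indicator measurableSet_orthant]

theorem mixDensity_eq (A : Matrix (Fin m) (Fin n) ℝ) (b : Fin m → ℝ) {w : Fin n → ℝ}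
    (hw : ∀ j, 0 < w j) (η : EuclideanSpace ℝ (Fin m)) :
    mixDensity A b w η = (∏ j, (w j : ℂ)) *
      Complex.exp (-(Complex.I * ∑ l, (η l : ℂ) * (b l : ℂ))) * complexZ A w η := by
  have hpos : 0 < ∏ j, w j := Finset.prod_pos fun j _ => hw j
  have hmeas : Measurable fun x : EuclideanSpace ℝ (Fin n) =>
      Real.toNNReal ((∏ j, w j) * Real.exp (-∑ j, w j * x j)) := by fun_prop
  rw [mixDensity, expProduct]
  simp only [ENNReal.ofReal]
  rw [integral_withDensity_eq_integral_smul hmeas, complexZ, ← integral_const_mul,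
    ← integral_indicator measurableSet_orthant]
  refine integral_congr_ae (Filter.Eventually.of_forall fun x => ?_)
  rw [complexDensity]
  by_cases hx : x ∈ orthant n
  · simp only [Set.indicator_of_mem hx, NNReal.smul_def, Complex.real_smul]
    rw [Real.coe_toNNReal _ (by positivity), Complex.ofReal_mul, Complex.ofReal_exp, mul_assoc,
      mul_assoc, ← Complex.exp_add, ← Complex.exp_add]
    push_cast
    congr 2
    simp only [sub_mul, Finset.sum_sub_distrib, mul_assoc, Finset.mul_sum]
    ring
  · simp [hx]

end Product

/-! ### Integrability of the product of inverse rates -/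

theorem exists_linearIndependent_cols {ι : Type*} [Fintype ι] (M : Matrix (Fin m) ι ℝ)
    (hM : M.rank = m) :
    ∃ σ : Fin m → ι, Function.Injective σ ∧ LinearIndependent ℝ fun l => M.col (σ l) := by
  obtain ⟨κ, a, ha, hspan, hli⟩ := exists_linearIndependent' ℝ M.col
  have : Finite κ := Finite.of_injective a ha
  have := Fintype.ofFinite κ
  have hcard : Fintype.card κ = m := by
    rw [← finrank_span_eq_card hli, hspan, ← Matrix.rank_eq_finrank_span_cols, hM]
  let e : Fin m ≃ κ := (Fintype.equivFinOfCardEq hcard).symm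
  exact ⟨a ∘ e, ha.comp e.injective, hli.comp e e.injective⟩

theorem continuous_innerCol (A : Matrix (Fin m) (Fin n) ℝ) (j : Fin n) :
    Continuous fun η : EuclideanSpace ℝ (Fin m) => innerCol A η j := by
  unfold innerCol
  fun_prop

theorem integrable_comp_continuousLinearEquiv {E F G : Type*} [NormedAddCommGroup E]
    [NormedSpace ℝ E] [MeasurableSpace E] [BorelSpace E] [FiniteDimensional ℝ E]
    [NormedAddCommGroup F] [NormedSpace ℝ F] [MeasurableSpace F] [BorelSpace F]
    [FiniteDimensional ℝ F] [NormedAddCommGroup G]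
    (μ : Measure E) [μ.IsAddHaarMeasure] (ν : Measure F) [ν.IsAddHaarMeasure]
    (e : E ≃L[ℝ] F) {g : F → G} (hg : Integrable g ν) : Integrable (fun x => g (e x)) μ := by
  have : (Measure.map e μ).IsAddHaarMeasure := e.isAddHaarMeasure_map μ
  have h : Integrable g (Measure.map e μ) := by
    rw [Measure.isAddLeftInvariant_eq_smul (Measure.map e μ) ν]
    exact hg.smul_measure_nnreal
  exact (integrable_map_equiv e.toHomeomorph.toMeasurableEquiv g).1 h

/-- The `m` independent columns provide linear coordinates `η ↦ ⟨η, A_{•σ l}⟩`, in which the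
integrand is a product of one-variable functions. -/
theorem integrable_prod_innerCol (A : Matrix (Fin m) (Fin n) ℝ) {σ : Fin m → Fin n}
    (hσ : LinearIndependent ℝ fun l => A.col (σ l)) {ψ : Fin m → ℝ → ℝ}
    (hψ : ∀ l, Integrable (ψ l)) :
    Integrable fun η : EuclideanSpace ℝ (Fin m) => ∏ l, ψ l (innerCol A η (σ l)) := by
  set M : Matrix (Fin m) (Fin m) ℝ := A.submatrix id σ with hM
  have hunit : IsUnit M := Matrix.linearIndependent_cols_iff_isUnit.1 hσ
  let T : EuclideanSpace ℝ (Fin m) →ₗ[ℝ] EuclideanSpace ℝ (Fin m) :=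
    (WithLp.linearEquiv 2 ℝ (Fin m → ℝ)).symm.toLinearMap ∘ₗ M.vecMulLinear ∘ₗ
      (WithLp.linearEquiv 2 ℝ (Fin m → ℝ)).toLinearMap
  have hT : Function.Injective T :=
    (WithLp.linearEquiv 2 ℝ (Fin m → ℝ)).symm.injective.comp
      ((Matrix.vecMul_injective_of_isUnit hunit).comp
        (WithLp.linearEquiv 2 ℝ (Fin m → ℝ)).injective)
  let e := (LinearEquiv.ofInjectiveEndo T hT).toContinuousLinearEquiv
  have he : ∀ η l, e η l = innerCol A η (σ l) := fun η l => rfl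
  simpa only [he] using
    integrable_comp_continuousLinearEquiv volume volume e (integrable_euclidean_prod hψ)

theorem integrable_norm_sub_I_mul_rpow {c p : ℝ} (hc : 0 < c) (hp : 1 < p) :
    Integrable fun t : ℝ => (c * ‖(c : ℂ) - Complex.I * t‖⁻¹) ^ p := by
  have h := (integrable_rpow_neg_one_add_norm_sq (E := ℝ) (μ := volume) (r := p)
    (by simpa using hp)).comp_div hc.ne'
  refine h.congr (Filter.Eventually.of_forall fun t => ?_)
  have h1 : ‖(c : ℂ) - Complex.I * t‖ = c * √(1 + ‖t / c‖ ^ 2) := by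
    rw [Complex.norm_eq_sqrt_sq_add_sq, ← Real.sqrt_sq hc.le, ← Real.sqrt_mul (by positivity),
      Real.sqrt_sq hc.le]
    congr 1
    simp only [Complex.sub_re, Complex.ofReal_re, Complex.mul_re, Complex.I_re, Complex.I_im,
      Complex.ofReal_im, Complex.sub_im, Complex.mul_im, Real.norm_eq_abs, sq_abs]
    field_simp
    ring
  have h2 : 0 < 1 + ‖t / c‖ ^ 2 := by positivity
  dsimp only
  rw [h1, mul_inv, mul_inv_cancel_left₀ hc.ne', Real.sqrt_eq_rpow, ← Real.rpow_neg h2.le,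
    ← Real.rpow_mul h2.le]
  congr 1
  ring

/-- For `j` minimizing `f`, `f j` is at most the geometric mean of the `f (σ j l)`, and the factors
outside `j` and the range of `σ j` are at most `1`. Summing over `j` removes the dependence of the
minimizer on the point. -/
theorem prod_le_sum_prod_rpow [NeZero n] {f : Fin n → ℝ} (hf0 : ∀ k, 0 < f k)
    (hf1 : ∀ k, f k ≤ 1) {σ : Fin n → Fin m → Fin n} (hσ : ∀ j, Function.Injective (σ j))
    (hσj : ∀ j l, σ j l ≠ j) :
    ∏ k, f k ≤ ∑ j, ∏ l, f (σ j l) ^ (1 + (m : ℝ)⁻¹) := by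
  obtain ⟨j, -, hj⟩ := Finset.exists_min_image Finset.univ f Finset.univ_nonempty
  have h1 : ∏ k, f k ≤ f j * ∏ l, f (σ j l) := by
    have hnot : j ∉ Finset.univ.map ⟨σ j, hσ j⟩ := by
      simpa using fun l => hσj j l
    rw [show f j * ∏ l, f (σ j l) = ∏ k ∈ Finset.cons j _ hnot, f k by
      rw [Finset.prod_cons, Finset.prod_map]; rfl]
    rw [← Finset.prod_mul_prod_compl (Finset.cons j _ hnot)]
    exact mul_le_of_le_one_right (Finset.prod_nonneg fun k _ => (hf0 k).le)
      (Finset.prod_le_one (fun k _ => (hf0 k).le) fun k _ => hf1 k)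
  have h2 : f j ≤ ∏ l, f (σ j l) ^ (m : ℝ)⁻¹ := by
    calc f j ≤ ∏ _l : Fin m, f j ^ (m : ℝ)⁻¹ := by
          rcases Nat.eq_zero_or_pos m with rfl | hm
          -- For `m = 0` the product is empty and the bound is just `f j ≤ 1`.
          · simpa using hf1 j
          · have : (m : ℝ) ≠ 0 := by positivity
            rw [Finset.prod_const, Finset.card_univ, Fintype.card_fin, ← Real.rpow_natCast,
              ← Real.rpow_mul (hf0 j).le, inv_mul_cancel₀ this, Real.rpow_one]
      _ ≤ _ := Finset.prod_le_prod (fun _ _ => Real.rpow_nonneg (hf0 j).le _) fun l _ =>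
          Real.rpow_le_rpow (hf0 j).le (hj _ (Finset.mem_univ _)) (by positivity)
  have h3 : f j * ∏ l, f (σ j l) ≤ ∏ l, f (σ j l) ^ (1 + (m : ℝ)⁻¹) := by
    simp_rw [Real.rpow_add (hf0 _), Real.rpow_one, Finset.prod_mul_distrib]
    rw [mul_comm]
    exact mul_le_mul_of_nonneg_left h2 (Finset.prod_nonneg fun l _ => (hf0 _).le)
  exact (h1.trans h3).trans (Finset.single_le_sum
    (f := fun j => ∏ l, f (σ j l) ^ (1 + (m : ℝ)⁻¹))
    (fun i _ => Finset.prod_nonneg fun l _ => Real.rpow_nonneg (hf0 _).le _) (Finset.mem_univ j))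

theorem integrable_prod_norm_rate_inv (A : Matrix (Fin m) (Fin n) ℝ) (hrank : A.rank = m)
    (hcol : ∀ j : Fin n,
      (A.submatrix id (Subtype.val : {k : Fin n // k ≠ j} → Fin n)).rank = A.rank)
    {w : Fin n → ℝ} (hw : ∀ j, 0 < w j) :
    Integrable fun η : EuclideanSpace ℝ (Fin m) => ∏ j, ‖rate A w η j‖⁻¹ := by
  have hcont : ∀ j, Continuous fun η : EuclideanSpace ℝ (Fin m) => ‖rate A w η j‖⁻¹ := fun j => by
    refine Continuous.inv₀ ?_ fun η => norm_ne_zero_iff.2 (rate_ne_zero A hw η j)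
    have := continuous_innerCol A j
    unfold rate
    fun_prop
  rcases Nat.eq_zero_or_pos n with rfl | hn
  · obtain rfl : m = 0 := by simpa using hrank.ge.trans A.rank_le_width
    simp
  have : NeZero n := ⟨hn.ne'⟩
  have hsel : ∀ j : Fin n, ∃ σ : Fin m → {k : Fin n // k ≠ j}, Function.Injective σ ∧
      LinearIndependent ℝ fun l => A.col (σ l) := fun j =>
    exists_linearIndependent_cols _ ((hcol j).trans hrank)
  choose σ hσ hli using hsel
  -- Multiplying by `w j`, the real part of the rate, normalizes each factor to lie in `(0, 1]`.
  set f : EuclideanSpace ℝ (Fin m) → Fin n → ℝ := fun η j => w j * ‖rate A w η j‖⁻¹ with hf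
  have hf0 : ∀ η k, 0 < f η k := fun η k =>
    mul_pos (hw k) (inv_pos.2 (norm_pos_iff.2 (rate_ne_zero A hw η k)))
  have hf1 : ∀ η k, f η k ≤ 1 := fun η k => by
    simp only [hf]
    rw [← div_eq_mul_inv, div_le_one (norm_pos_iff.2 (rate_ne_zero A hw η k))]
    simpa [rate_re, abs_of_pos (hw k)] using Complex.abs_re_le_norm (rate A w η k)
  have hdom : Integrable fun η : EuclideanSpace ℝ (Fin m) =>
      ∑ j, ∏ l, f η (σ j l) ^ (1 + (m : ℝ)⁻¹) := by
    refine integrable_finsetSum _ fun j _ => ?_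
    rcases Nat.eq_zero_or_pos m with rfl | hm
    · simp
    refine integrable_prod_innerCol A (hli j)
      (ψ := fun l t => (w (σ j l) * ‖(w (σ j l) : ℂ) - Complex.I * t‖⁻¹) ^ (1 + (m : ℝ)⁻¹))
      fun l => integrable_norm_sub_I_mul_rpow (hw _) ?_
    have : 0 < (m : ℝ)⁻¹ := by positivity
    linarith
  have hprod : Integrable fun η => ∏ k, f η k := by
    refine hdom.mono' (Continuous.aestronglyMeasurable ?_) (Filter.Eventually.of_forall fun η => ?_)
    · exact continuous_finsetProd _ fun j _ => continuous_const.mul (hcont j)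
    · rw [Real.norm_of_nonneg (Finset.prod_nonneg fun k _ => (hf0 η k).le)]
      exact prod_le_sum_prod_rpow (hf0 η) (hf1 η)
        (fun j => Subtype.val_injective.comp (hσ j)) fun j l => (σ j l).2
  have hw0 : ∏ j, w j ≠ 0 := Finset.prod_ne_zero_iff.2 fun j _ => (hw j).ne'
  refine (hprod.const_mul (∏ j, w j)⁻¹).congr (Filter.Eventually.of_forall fun η => ?_)
  simp only [hf, Finset.prod_mul_distrib]
  rw [inv_mul_cancel_left₀ hw0]

/-! ### Mass, mean and entropy of the product exponential law -/

section ExpProduct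

theorem integral_rpow_mul_exp_neg_mul_Ici {a r : ℝ} (ha : 0 < a) (hr : 0 < r) :
    IntegrableOn (fun t : ℝ => t ^ (a - 1) * Real.exp (-(r * t))) (Set.Ici 0) ∧
      ∫ t in Set.Ici (0 : ℝ), t ^ (a - 1) * Real.exp (-(r * t)) = (1 / r) ^ a * Real.Gamma a := by
  have h := Real.integral_rpow_mul_exp_neg_mul_Ioi ha hr
  rw [← integral_Ici_eq_integral_Ioi] at h
  -- The integral of a non-integrable function is `0` by convention, so a nonzero value proves
  -- integrability.
  refine ⟨Integrable.of_integral_ne_zero ?_, h⟩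
  rw [h]
  have := Real.Gamma_pos_of_pos ha
  positivity

theorem exp_density_integral {r : ℝ} (hr : 0 < r) :
    IntegrableOn (fun t : ℝ => r * Real.exp (-(r * t))) (Set.Ici 0) ∧
      ∫ t in Set.Ici (0 : ℝ), r * Real.exp (-(r * t)) = 1 := by
  obtain ⟨h1, h2⟩ := integral_rpow_mul_exp_neg_mul_Ici (a := 1) one_pos hr
  simp only [sub_self, Real.rpow_zero, one_mul, Real.rpow_one, Real.Gamma_one, mul_one] at h1 h2
  exact ⟨h1.const_mul r, by rw [integral_const_mul, h2, mul_one_div_cancel hr.ne']⟩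

theorem exp_density_mean {r : ℝ} (hr : 0 < r) :
    IntegrableOn (fun t : ℝ => r * Real.exp (-(r * t)) * t) (Set.Ici 0) ∧
      ∫ t in Set.Ici (0 : ℝ), r * Real.exp (-(r * t)) * t = r⁻¹ := by
  obtain ⟨h1, h2⟩ := integral_rpow_mul_exp_neg_mul_Ici (a := 2) two_pos hr
  have e : ∀ t : ℝ, r * Real.exp (-(r * t)) * t =
      r * (t ^ ((2 : ℝ) - 1) * Real.exp (-(r * t))) := fun t => by
    rw [show (2 : ℝ) - 1 = 1 by norm_num, Real.rpow_one]
    ring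
  simp_rw [e]
  refine ⟨h1.const_mul r, ?_⟩
  rw [integral_const_mul, h2, Real.Gamma_two]
  rw [Real.rpow_two]
  field_simp

/-- The real density of `expProduct w`. -/
def expDensity (w : Fin n → ℝ) : EuclideanSpace ℝ (Fin n) → ℝ :=
  (orthant n).indicator fun x => (∏ j, w j) * Real.exp (-∑ j, w j * x j)

theorem expDensity_eq_prod (w : Fin n → ℝ) (x : EuclideanSpace ℝ (Fin n)) :
    expDensity w x =
      ∏ j, (Set.Ici 0).indicator (fun t : ℝ => w j * Real.exp (-(w j * t))) (x j) := by
  rw [← indicator_box_prod, ← orthant_eq_box, expDensity]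
  congr 1
  ext x
  rw [Finset.prod_mul_distrib, ← Real.exp_sum, Finset.sum_neg_distrib]

theorem measurable_expDensity (w : Fin n → ℝ) : Measurable (expDensity w) :=
  Measurable.indicator (by fun_prop) measurableSet_orthant

theorem expDensity_nonneg {w : Fin n → ℝ} (hw : ∀ j, 0 < w j) (x : EuclideanSpace ℝ (Fin n)) :
    0 ≤ expDensity w x :=
  Set.indicator_nonneg (fun _ _ => mul_nonneg (Finset.prod_nonneg fun j _ => (hw j).le)
    (Real.exp_nonneg _)) x

theorem expProduct_eq_withDensity (w : Fin n → ℝ) :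
    expProduct w = volume.withDensity fun x => ENNReal.ofReal (expDensity w x) := by
  rw [withDensity_indicator_expProduct]
  congr 1
  ext x
  by_cases hx : x ∈ orthant n <;> simp [expDensity, hx]

theorem integrable_expProduct_iff {w : Fin n → ℝ} (hw : ∀ j, 0 < w j)
    {φ : EuclideanSpace ℝ (Fin n) → ℝ} :
    Integrable φ (expProduct w) ↔ Integrable fun x => expDensity w x * φ x := by
  rw [expProduct_eq_withDensity,
    integrable_withDensity_iff_integrable_smul' (measurable_expDensity w).ennreal_ofReal (by simp)]
  simp_rw [ENNReal.toReal_ofReal (expDensity_nonneg hw _), smul_eq_mul]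

theorem integral_expProduct {w : Fin n → ℝ} (hw : ∀ j, 0 < w j)
    (φ : EuclideanSpace ℝ (Fin n) → ℝ) :
    ∫ x, φ x ∂(expProduct w) = ∫ x, expDensity w x * φ x := by
  rw [expProduct_eq_withDensity, integral_withDensity_eq_integral_toReal_smul
    (measurable_expDensity w).ennreal_ofReal (by simp)]
  simp_rw [ENNReal.toReal_ofReal (expDensity_nonneg hw _), smul_eq_mul]

theorem expDensity_mul_prod (w : Fin n → ℝ) (g : Fin n → ℝ → ℝ) (x : EuclideanSpace ℝ (Fin n)) :
    expDensity w x * ∏ j, g j (x j) =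
      ∏ j, (Set.Ici 0).indicator (fun t : ℝ => w j * Real.exp (-(w j * t)) * g j t) (x j) := by
  rw [expDensity_eq_prod, ← Finset.prod_mul_distrib]
  exact Finset.prod_congr rfl fun j _ => by
    by_cases hx : x j ∈ Set.Ici 0 <;> simp [hx]

theorem integral_expProduct_prod {w : Fin n → ℝ} (hw : ∀ j, 0 < w j) (g : Fin n → ℝ → ℝ) :
    ∫ x, ∏ j, g j (x j) ∂(expProduct w) =
      ∏ j, ∫ t in Set.Ici (0 : ℝ), w j * Real.exp (-(w j * t)) * g j t := by
  simp_rw [integral_expProduct hw, expDensity_mul_prod, integral_euclidean_prod,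
    integral_indicator measurableSet_Ici]

theorem integrable_expProduct_prod {w : Fin n → ℝ} (hw : ∀ j, 0 < w j) {g : Fin n → ℝ → ℝ}
    (hg : ∀ j, IntegrableOn (fun t => w j * Real.exp (-(w j * t)) * g j t) (Set.Ici 0)) :
    Integrable (fun x : EuclideanSpace ℝ (Fin n) => ∏ j, g j (x j)) (expProduct w) := by
  simp_rw [integrable_expProduct_iff hw, expDensity_mul_prod]
  exact integrable_euclidean_prod fun j => (integrable_indicator_iff measurableSet_Ici).2 (hg j)

theorem isProbabilityMeasure_expProduct {w : Fin n → ℝ} (hw : ∀ j, 0 < w j) :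
    IsProbabilityMeasure (expProduct w) := by
  have h := integral_expProduct_prod hw fun _ _ => 1
  simp only [Finset.prod_const_one, mul_one, integral_const, smul_eq_mul,
    (exp_density_integral (hw _)).2] at h
  exact ⟨(ENNReal.toReal_eq_one_iff _).1 h⟩

theorem expProduct_mean {w : Fin n → ℝ} (hw : ∀ j, 0 < w j) (j : Fin n) :
    Integrable (fun x : EuclideanSpace ℝ (Fin n) => x j) (expProduct w) ∧
      ∫ x, x j ∂(expProduct w) = (w j)⁻¹ := by
  -- A coordinate is a product of one-variable functions, all but one of them constant `1`, so the
  -- product formulas apply.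
  have e : ∀ x : EuclideanSpace ℝ (Fin n),
      x j = ∏ k, (if k = j then (fun t : ℝ => t) else fun _ => 1) (x k) := fun x => by
    rw [Finset.prod_eq_single j] <;> simp +contextual
  simp_rw [e]
  constructor
  · refine integrable_expProduct_prod hw (g := fun k => if k = j then (fun t => t) else fun _ => 1)
      fun k => ?_
    by_cases hk : k = j
    · simpa [hk] using (exp_density_mean (hw j)).1
    · simpa [hk] using (exp_density_integral (hw k)).1
  · rw [integral_expProduct_prod hw fun k => if k = j then (fun t => t) else fun _ => 1,
      Finset.prod_eq_single j]
    · simpa using (exp_density_mean (hw j)).2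
    · intro k _ hk
      simpa [hk] using (exp_density_integral (hw k)).2
    · simp

theorem integrable_id_expProduct {w : Fin n → ℝ} (hw : ∀ j, 0 < w j) :
    Integrable (fun x => x) (expProduct w) :=
  Integrable.of_eval_piLp fun j => (expProduct_mean hw j).1

theorem integral_id_expProduct {w : Fin n → ℝ} (hw : ∀ j, 0 < w j) (j : Fin n) :
    (∫ x, x ∂(expProduct w)) j = (w j)⁻¹ := by
  rw [← (expProduct_mean hw j).2]
  exact ((EuclideanSpace.proj (𝕜 := ℝ) j).integral_comp_comm (integrable_id_expProduct hw)).symm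

theorem entropy_expProduct {w : Fin n → ℝ} (hw : ∀ j, 0 < w j) :
    entropy (expProduct w) = ((n - ∑ j, Real.log (w j) : ℝ) : EReal) := by
  have hprob := isProbabilityMeasure_expProduct hw
  have hpos : 0 < ∏ j, w j := Finset.prod_pos fun j _ => hw j
  have hac : expProduct w ≪ volume := by
    rw [expProduct_eq_withDensity]
    exact withDensity_absolutelyContinuous _ _
  have hrn : (expProduct w).rnDeriv volume =ᵐ[volume] fun x => ENNReal.ofReal (expDensity w x) := by
    rw [expProduct_eq_withDensity]
    exact Measure.rnDeriv_withDensity _ (measurable_expDensity w).ennreal_ofReal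
  have hae : (fun x => ((expProduct w).rnDeriv volume x).toReal *
      Real.log ((expProduct w).rnDeriv volume x).toReal) =ᵐ[volume]
      fun x => expDensity w x * (∑ j, Real.log (w j) - ∑ j, w j * x j) := by
    filter_upwards [hrn] with x hx
    rw [hx, ENNReal.toReal_ofReal (expDensity_nonneg hw x)]
    by_cases hx : x ∈ orthant n
    · rw [expDensity, Set.indicator_of_mem hx, Real.log_mul hpos.ne' (Real.exp_ne_zero _),
        Real.log_exp, Real.log_prod fun j _ => (hw j).ne', sub_eq_add_neg]
    · simp [expDensity, hx]
  have hsum : Integrable (fun x => ∑ j, w j * x j) (expProduct w) :=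
    integrable_finsetSum _ fun j _ => (expProduct_mean hw j).1.const_mul _
  have hint : Integrable (fun x => ∑ j, Real.log (w j) - ∑ j, w j * x j) (expProduct w) :=
    (integrable_const _).sub hsum
  rw [entropy, if_pos ⟨hac, (integrable_congr hae).2 ((integrable_expProduct_iff hw).1 hint)⟩,
    integral_congr_ae hae, ← integral_expProduct hw, integral_sub (integrable_const _) hsum,
    integral_finsetSum _ fun j _ => (expProduct_mean hw j).1.const_mul _]
  simp_rw [integral_const_mul, (expProduct_mean hw _).2, mul_inv_cancel₀ (hw _).ne']
  simp

theorem expProduct_compl_orthant (w : Fin n → ℝ) : expProduct w (orthant n)ᶜ = 0 := by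
  rw [expProduct]
  refine withDensity_absolutelyContinuous _ _ ?_
  rw [Measure.restrict_apply measurableSet_orthant.compl]
  simp

end ExpProduct

/-! ### Entropy maximality puts the rates in the row span -/

section MaxEntropy

/-- Duality: a functional that vanishes on the rows but not at `w` is, in coordinates, a kernel
vector not orthogonal to `w`. -/
theorem mem_span_row_of_forall_mulVec_eq_zero {A : Matrix (Fin m) (Fin n) ℝ} {w : Fin n → ℝ}
    (h : ∀ v, A.mulVec v = 0 → ∑ j, w j * v j = 0) :
    w ∈ Submodule.span ℝ (Set.range A.row) := by
  by_contra hw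
  obtain ⟨f, hfw, hf⟩ := Submodule.exists_le_ker_of_notMem hw
  have hfv : ∀ u : Fin n → ℝ, f u = ∑ j, u j * f (Pi.single j 1) := fun u => by
    conv_lhs => rw [pi_eq_sum_univ' u]
    simp [map_sum]
  refine hfw ?_
  rw [hfv]
  refine h _ (funext fun i => ?_)
  rw [Pi.zero_apply, ← hf (Submodule.subset_span ⟨i, rfl⟩), hfv]
  rfl

/-- The competitors are exponential laws with means `(w j)⁻¹ + t * v j`, `v ∈ ker A`, which remain
admissible for small `t`. The derivative of their entropy at `t = 0` is `∑ w j * v j`. -/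
theorem IsMaxEntropy.mem_span_row {A : Matrix (Fin m) (Fin n) ℝ} {b : Fin m → ℝ} {w : Fin n → ℝ}
    (hw : ∀ j, 0 < w j) (h : IsMaxEntropy A b w) : w ∈ Submodule.span ℝ (Set.range A.row) := by
  refine mem_span_row_of_forall_mulVec_eq_zero fun v hv => ?_
  obtain ⟨⟨-, -, -, hmean⟩, hmax⟩ := h
  have hb : A.mulVec (fun j => (w j)⁻¹) = b := by
    rw [← hmean.2]
    congr 1
    exact funext fun j => (integral_id_expProduct hw j).symm
  have hpos : ∀ᶠ t : ℝ in nhds 0, ∀ j, 0 < (w j)⁻¹ + t * v j := by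
    refine Filter.eventually_all.2 fun j => ?_
    have : ContinuousAt (fun t : ℝ => (w j)⁻¹ + t * v j) 0 := by fun_prop
    exact this.eventually_const_lt (by simpa using hw j)
  have hloc : IsLocalMax (fun t : ℝ => ∑ j, Real.log ((w j)⁻¹ + t * v j)) 0 := by
    filter_upwards [hpos] with t ht
    have hw' : ∀ j, 0 < ((w j)⁻¹ + t * v j)⁻¹ := fun j => inv_pos.2 (ht j)
    have hmem : expProduct (fun j => ((w j)⁻¹ + t * v j)⁻¹) ∈ meanInPolytope A b := by
      refine ⟨isProbabilityMeasure_expProduct hw', expProduct_compl_orthant _,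
        integrable_id_expProduct hw', fun j => ?_, ?_⟩
      · rw [integral_id_expProduct hw', inv_inv]
        exact (ht j).le
      · have : (∫ x, x ∂(expProduct fun j => ((w j)⁻¹ + t * v j)⁻¹)).ofLp =
            (fun j => (w j)⁻¹) + t • v := funext fun j => by
          rw [integral_id_expProduct hw', inv_inv]
          rfl
        rw [this, Matrix.mulVec_add, Matrix.mulVec_smul, hv, hb, smul_zero, add_zero]
    have hle := hmax _ hmem
    rw [entropy_expProduct hw, entropy_expProduct hw', EReal.coe_le_coe_iff] at hle
    simp only [Real.log_inv, Finset.sum_neg_distrib] at hle ⊢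
    simp only [zero_mul, add_zero, Real.log_inv, Finset.sum_neg_distrib]
    linarith
  have hder : HasDerivAt (fun t : ℝ => ∑ j, Real.log ((w j)⁻¹ + t * v j)) (∑ j, w j * v j) 0 := by
    refine HasDerivAt.fun_sum fun j _ => ?_
    have h1 : HasDerivAt (fun t : ℝ => (w j)⁻¹ + t * v j) (v j) 0 := by
      simpa using ((hasDerivAt_id (0 : ℝ)).mul_const (v j)).const_add (w j)⁻¹
    have h2 := h1.log (by simpa using (hw j).ne')
    simpa [div_eq_mul_inv, mul_comm] using h2
  exact hloc.hasDerivAt_eq_zero hder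

end MaxEntropy

/-! ### Fubini along the fibers of a linear map -/

section Disintegration

/-- If `L` is a right inverse of `P : E → F`, then `(y, v) ↦ L y + v` is an equivalence of
`F × ker P` with `E`. -/
def fiberEquiv {E F : Type*} [AddCommGroup E] [Module ℝ E] [AddCommGroup F] [Module ℝ F]
    (P : E →ₗ[ℝ] F) (L : F →ₗ[ℝ] E) (hL : ∀ y, P (L y) = y) :
    (F × LinearMap.ker P) ≃ₗ[ℝ] E where
  toFun p := L p.1 + p.2
  map_add' p q := by simp only [Prod.fst_add, Prod.snd_add, map_add, Submodule.coe_add]; abel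
  map_smul' c p := by simp
  invFun x := (P x, ⟨x - L (P x), by simp [hL]⟩)
  left_inv p := by
    have : P p.2 = 0 := p.2.2
    ext <;> simp [hL, this]
  right_inv x := by simp

/-- Uniqueness of Haar measure replaces a Jacobian computation. The constant `c` does not depend on
`f`, so it will cancel. -/
theorem exists_integral_fiber {E F : Type*} [NormedAddCommGroup E] [NormedSpace ℝ E]
    [MeasurableSpace E] [BorelSpace E] [FiniteDimensional ℝ E] [NormedAddCommGroup F]
    [NormedSpace ℝ F] [MeasurableSpace F] [BorelSpace F] [FiniteDimensional ℝ F]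
    (P : E →ₗ[ℝ] F) (L : F →ₗ[ℝ] E) (hL : ∀ y, P (L y) = y) (μ : Measure E) [μ.IsAddHaarMeasure]
    (κ : Measure F) [κ.IsAddHaarMeasure] (ν : Measure (LinearMap.ker P)) [ν.IsAddHaarMeasure] :
    ∃ c : ℝ, 0 < c ∧ ∀ f : E → ℂ, Integrable f μ →
      Integrable (fun p : F × LinearMap.ker P => f (L p.1 + p.2)) (κ.prod ν) ∧
      ∫ x, f x ∂μ = c * ∫ y, ∫ v : LinearMap.ker P, f (L y + v) ∂ν ∂κ := by
  let e : (F × LinearMap.ker P) ≃L[ℝ] E := (fiberEquiv P L hL).toContinuousLinearEquiv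
  have : (Measure.map e (κ.prod ν)).IsAddHaarMeasure := e.isAddHaarMeasure_map _
  refine ⟨Measure.addHaarScalarFactor μ (Measure.map e (κ.prod ν)),
    Measure.addHaarScalarFactor_pos_of_isAddHaarMeasure .., fun f hf => ?_⟩
  have hint := integrable_comp_continuousLinearEquiv (κ.prod ν) μ e hf
  refine ⟨hint, ?_⟩
  conv_lhs => rw [Measure.isAddLeftInvariant_eq_smul μ (Measure.map e (κ.prod ν))]
  rw [integral_smul_nnreal_measure, NNReal.smul_def, Complex.real_smul]
  congr 1
  refine (integral_map_equiv e.toHomeomorph.toMeasurableEquiv f).trans ?_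
  exact integral_prod _ hint

end Disintegration

/-! ### Geometry and measure of the fibers -/

section Fiber

/-- The linear map `x ↦ A x` between Euclidean spaces. -/
def euclMap (A : Matrix (Fin m) (Fin n) ℝ) :
    EuclideanSpace ℝ (Fin n) →ₗ[ℝ] EuclideanSpace ℝ (Fin m) :=
  (WithLp.linearEquiv 2 ℝ (Fin m → ℝ)).symm.toLinearMap ∘ₗ A.mulVecLin ∘ₗ
    (WithLp.linearEquiv 2 ℝ (Fin n → ℝ)).toLinearMap

theorem euclMap_apply (A : Matrix (Fin m) (Fin n) ℝ) (x : EuclideanSpace ℝ (Fin n)) :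
    euclMap A x = WithLp.toLp 2 (A.mulVec x.ofLp) := rfl

theorem euclMap_surjective {A : Matrix (Fin m) (Fin n) ℝ} (hrank : A.rank = m) :
    Function.Surjective (euclMap A) := by
  have h : Function.Surjective A.mulVecLin := by
    rw [← LinearMap.range_eq_top]
    exact Submodule.eq_top_of_finrank_eq (by rw [← Matrix.rank, hrank]; simp)
  exact (WithLp.linearEquiv 2 ℝ (Fin m → ℝ)).symm.surjective.comp
    (h.comp (WithLp.linearEquiv 2 ℝ (Fin n → ℝ)).surjective)

theorem finrank_ker_euclMap {A : Matrix (Fin m) (Fin n) ℝ} (hrank : A.rank = m) :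
    (Module.finrank ℝ (LinearMap.ker (euclMap A)) : ℝ) = n - m := by
  have h := (euclMap A).finrank_range_add_finrank_ker
  rw [LinearMap.range_eq_top.2 (euclMap_surjective hrank), finrank_top, finrank_euclideanSpace,
    finrank_euclideanSpace, Fintype.card_fin, Fintype.card_fin] at h
  rw [eq_sub_iff_add_eq']
  exact_mod_cast h

theorem sum_innerCol_mul (A : Matrix (Fin m) (Fin n) ℝ) (η : EuclideanSpace ℝ (Fin m))
    (x : EuclideanSpace ℝ (Fin n)) :
    ∑ j, innerCol A η j * x j = ∑ l, η l * euclMap A x l := by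
  simp only [innerCol, euclMap_apply, Matrix.mulVec, dotProduct, Finset.sum_mul, Finset.mul_sum]
  rw [Finset.sum_comm]
  exact Finset.sum_congr rfl fun _ _ => Finset.sum_congr rfl fun _ _ => by ring

theorem mem_span_row_iff {A : Matrix (Fin m) (Fin n) ℝ} {w : Fin n → ℝ} :
    w ∈ Submodule.span ℝ (Set.range A.row) ↔
      ∃ l : EuclideanSpace ℝ (Fin m), ∀ j, innerCol A l j = w j := by
  rw [Submodule.mem_span_range_iff_exists_fun]
  constructor
  · rintro ⟨c, rfl⟩
    exact ⟨WithLp.toLp 2 c, fun j => by simp [innerCol]⟩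
  · rintro ⟨l, hl⟩
    exact ⟨l.ofLp, funext fun j => by simp [← hl, innerCol]⟩

/-- The remaining columns still span, so column `j` is a combination of them. This relation is a
kernel vector with `j`-th entry `-1`. -/
theorem exists_ker_apply_ne_zero {A : Matrix (Fin m) (Fin n) ℝ} (hrank : A.rank = m) (j : Fin n)
    (hcol : (A.submatrix id (Subtype.val : {k : Fin n // k ≠ j} → Fin n)).rank = A.rank) :
    ∃ v : LinearMap.ker (euclMap A), (v : EuclideanSpace ℝ (Fin n)) j ≠ 0 := by
  set M := A.submatrix id (Subtype.val : {k : Fin n // k ≠ j} → Fin n)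
  have h : Function.Surjective M.mulVecLin := by
    rw [← LinearMap.range_eq_top]
    exact Submodule.eq_top_of_finrank_eq (by rw [← Matrix.rank, hcol, hrank]; simp)
  obtain ⟨u, hu⟩ := h (A.col j)
  let v : Fin n → ℝ := fun k => if hk : k = j then -1 else u ⟨k, hk⟩
  have hvj : v j = -1 := by simp [v]
  refine ⟨⟨WithLp.toLp 2 v, ?_⟩, by simp [hvj]⟩
  rw [LinearMap.mem_ker, euclMap_apply]
  ext i
  have hui := congrFun hu i
  simp only [Matrix.mulVecLin_apply, Matrix.mulVec, dotProduct, Matrix.col_apply] at hui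
  simp only [Matrix.mulVec, dotProduct, PiLp.zero_apply]
  rw [Fintype.sum_eq_add_sum_subtype_ne _ j, hvj, ← hui]
  have : ∀ k : {k : Fin n // k ≠ j}, v k = u k := fun k => by simp [v, k.2]
  simp [this, M]

/-- The points of a box in the fiber of `A` through `x₀`, as a subset of the kernel of `A`. -/
def fiberSet (A : Matrix (Fin m) (Fin n) ℝ) (x₀ : EuclideanSpace ℝ (Fin n)) (E : Fin n → Set ℝ) :
    Set (LinearMap.ker (euclMap A)) :=
  {v | x₀ + (v : EuclideanSpace ℝ (Fin n)) ∈ box E ∩ orthant n}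

theorem isometry_add_ker (A : Matrix (Fin m) (Fin n) ℝ) (x₀ : EuclideanSpace ℝ (Fin n)) :
    Isometry fun v : LinearMap.ker (euclMap A) => x₀ + (v : EuclideanSpace ℝ (Fin n)) :=
  (IsometryEquiv.addLeft x₀).isometry.comp isometry_subtype_coe

theorem image_fiberSet {A : Matrix (Fin m) (Fin n) ℝ} {b : Fin m → ℝ}
    {x₀ : EuclideanSpace ℝ (Fin n)} (hx₀ : euclMap A x₀ = WithLp.toLp 2 b) (E : Fin n → Set ℝ) :
    (fun v : LinearMap.ker (euclMap A) => x₀ + (v : EuclideanSpace ℝ (Fin n))) ''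
      fiberSet A x₀ E = box E ∩ polytope A b := by
  have hP : ∀ x : EuclideanSpace ℝ (Fin n), A.mulVec x.ofLp = b ↔ euclMap A x = WithLp.toLp 2 b :=
    fun x => by rw [euclMap_apply, (WithLp.toLp_injective 2).eq_iff]
  ext x
  simp only [Set.mem_image, fiberSet, Set.mem_ofPred_eq, Set.mem_inter_iff, polytope, hP]
  constructor
  · rintro ⟨v, ⟨h1, h2⟩, rfl⟩
    refine ⟨h1, h2, ?_⟩
    rw [map_add, hx₀, LinearMap.mem_ker.1 v.2, add_zero]
  · rintro ⟨h1, h2, h3⟩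
    exact ⟨⟨x - x₀, by rw [LinearMap.mem_ker, map_sub, h3, hx₀, sub_self]⟩, by simpa using ⟨h1, h2⟩,
      by simp⟩

theorem hausdorffMeasure_box_inter_polytope {A : Matrix (Fin m) (Fin n) ℝ} (hrank : A.rank = m)
    {b : Fin m → ℝ} {x₀ : EuclideanSpace ℝ (Fin n)} (hx₀ : euclMap A x₀ = WithLp.toLp 2 b)
    (E : Fin n → Set ℝ) :
    Measure.hausdorffMeasure ((n : ℝ) - m) (box E ∩ polytope A b) =
      Measure.hausdorffMeasure (Module.finrank ℝ (LinearMap.ker (euclMap A)))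
        (fiberSet A x₀ E) := by
  rw [← image_fiberSet hx₀, ← finrank_ker_euclMap hrank,
    (isometry_add_ker A x₀).hausdorffMeasure_image (Or.inl (Nat.cast_nonneg _))]

theorem uniform_real_box {A : Matrix (Fin m) (Fin n) ℝ} (hrank : A.rank = m)
    {b : Fin m → ℝ} {x₀ : EuclideanSpace ℝ (Fin n)} (hx₀ : euclMap A x₀ = WithLp.toLp 2 b)
    {E : Fin n → Set ℝ} (hE : ∀ j, MeasurableSet (E j))
    {ν : Measure (LinearMap.ker (euclMap A))}
    (hν : ν = Measure.hausdorffMeasure (Module.finrank ℝ (LinearMap.ker (euclMap A)))) :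
    (uniform A b).real (box E) =
      (ν.real (fiberSet A x₀ fun _ => Set.univ))⁻¹ * ν.real (fiberSet A x₀ E) := by
  have h := hausdorffMeasure_box_inter_polytope hrank hx₀ fun _ : Fin n => Set.univ
  rw [box_univ, Set.univ_inter] at h
  rw [Measure.real, uniform, Measure.smul_apply, Measure.restrict_apply (measurableSet_box hE),
    hausdorffMeasure_box_inter_polytope hrank hx₀, h, smul_eq_mul, ENNReal.toReal_mul,
    ENNReal.toReal_inv, hν]
  rfl

/-- The strictly positive point yields a nonempty open subset, and compactness gives finiteness;
without it `ν.real` would be `0`. -/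
theorem measure_fiberSet_univ {A : Matrix (Fin m) (Fin n) ℝ}
    {b : Fin m → ℝ} {x₀ : EuclideanSpace ℝ (Fin n)} (hx₀ : euclMap A x₀ = WithLp.toLp 2 b)
    (hcompact : IsCompact (polytope A b)) (hint : ∃ x ∈ polytope A b, ∀ j, 0 < x j)
    (ν : Measure (LinearMap.ker (euclMap A))) [ν.IsAddHaarMeasure] :
    0 < ν.real (fiberSet A x₀ fun _ => Set.univ) := by
  have himage := image_fiberSet hx₀ fun _ : Fin n => Set.univ
  rw [box_univ, Set.univ_inter] at himage
  have hiso := isometry_add_ker A x₀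
  refine ENNReal.toReal_pos ?_ ?_
  · obtain ⟨x, hx, hpos⟩ := hint
    rw [← himage] at hx
    obtain ⟨v, -, rfl⟩ := hx
    let U : Set (LinearMap.ker (euclMap A)) :=
      ⋂ j, {v | 0 < (x₀ + (v : EuclideanSpace ℝ (Fin n))) j}
    have hU : IsOpen U := isOpen_iInter_of_finite fun j =>
      isOpen_lt continuous_const (by fun_prop)
    have hsub : U ⊆ fiberSet A x₀ fun _ => Set.univ := fun v hv =>
      ⟨fun _ => trivial, fun j => (Set.mem_iInter.1 hv j).le⟩
    have hne : U.Nonempty := ⟨v, Set.mem_iInter.2 hpos⟩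
    exact ((hU.measure_pos ν hne).trans_le (measure_mono hsub)).ne'
  · refine IsCompact.measure_ne_top ?_
    rw [hiso.isEmbedding.isCompact_iff, himage]
    exact hcompact

/-- The coordinate is nonconstant on the fiber, hence an open map, so the set is the frontier of the
preimage of `S`. That preimage is convex, and frontiers of convex sets are Haar-null. -/
theorem measure_frontier_coord {A : Matrix (Fin m) (Fin n) ℝ} (hrank : A.rank = m) (j : Fin n)
    (hcol : (A.submatrix id (Subtype.val : {k : Fin n // k ≠ j} → Fin n)).rank = A.rank)
    (x₀ : EuclideanSpace ℝ (Fin n)) {S : Set ℝ} (hS : S.OrdConnected)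
    (ν : Measure (LinearMap.ker (euclMap A))) [ν.IsAddHaarMeasure] :
    ν {v | (x₀ + (v : EuclideanSpace ℝ (Fin n))) j ∈ frontier S} = 0 := by
  let ℓ : LinearMap.ker (euclMap A) →ₗ[ℝ] ℝ :=
    (EuclideanSpace.proj (𝕜 := ℝ) j).toLinearMap ∘ₗ (LinearMap.ker (euclMap A)).subtype
  have hℓ : Function.Surjective ℓ := by
    obtain ⟨v, hv⟩ := exists_ker_apply_ne_zero hrank j hcol
    exact LinearMap.surjective fun h => hv (DFunLike.congr_fun h v)
  have hopen : IsOpenMap fun v => x₀ j + ℓ v :=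
    (isOpenMap_add_left (x₀ j)).comp (ℓ.isOpenMap_of_finiteDimensional hℓ)
  have hcont : Continuous fun v => x₀ j + ℓ v :=
    continuous_const.add ℓ.continuous_of_finiteDimensional
  have hconv : Convex ℝ ((fun v => x₀ j + ℓ v) ⁻¹' S) :=
    (hS.convex.translate_preimage_right (x₀ j)).linear_preimage ℓ
  rw [← hconv.addHaar_frontier ν, ← hopen.preimage_frontier_eq_frontier_preimage hcont]
  rfl

end Fiber

/-! ### Fourier inversion for the fiber integral -/

section Inversion

/-- The unnormalized mass `∫_E exp (- ∑ j, (w j - i ⟨η, A_{•j}⟩) x j) 1_{x ≥ 0} dx` of a box. -/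
def boxTransform (A : Matrix (Fin m) (Fin n) ℝ) (w : Fin n → ℝ) (E : Fin n → Set ℝ)
    (η : EuclideanSpace ℝ (Fin m)) : ℂ :=
  ∫ x in box E, complexDensity A w η x

/-- The parameter `η` enters only through the phase `exp(i⟨A x, η⟩)`, a Fourier kernel constant on
fibers. -/
theorem complexDensity_eq_mul (A : Matrix (Fin m) (Fin n) ℝ) (w : Fin n → ℝ)
    (η : EuclideanSpace ℝ (Fin m)) (x : EuclideanSpace ℝ (Fin n)) :
    complexDensity A w η x =
      Complex.exp ((inner ℝ (euclMap A x) η : ℝ) * Complex.I) * complexDensity A w 0 x := by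
  have h0 : ∀ j, innerCol A (0 : EuclideanSpace ℝ (Fin m)) j = 0 := fun j => by simp [innerCol]
  have hinner : inner ℝ (euclMap A x) η = ∑ j, innerCol A η j * x j := by
    rw [sum_innerCol_mul, PiLp.inner_apply]
    rfl
  by_cases hx : x ∈ orthant n
  · simp only [complexDensity, Set.indicator_of_mem hx, ← Complex.exp_add, h0, hinner]
    congr 1
    push_cast
    simp only [sub_mul, Finset.sum_sub_distrib, Finset.sum_mul]
    simp only [mul_zero, zero_mul, Finset.sum_const_zero, sub_zero, neg_sub]
    rw [sub_eq_add_neg]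
    congr 1
    exact Finset.sum_congr rfl fun _ _ => by ring
  · simp [complexDensity, hx]

theorem norm_complexDensity (A : Matrix (Fin m) (Fin n) ℝ) (w : Fin n → ℝ)
    (η : EuclideanSpace ℝ (Fin m)) (x : EuclideanSpace ℝ (Fin n)) :
    ‖complexDensity A w η x‖ = ‖complexDensity A w 0 x‖ := by
  rw [complexDensity_eq_mul, norm_mul, Complex.norm_exp_ofReal_mul_I, one_mul]

theorem continuous_boxTransform (A : Matrix (Fin m) (Fin n) ℝ) {w : Fin n → ℝ}
    (hw : ∀ j, 0 < w j) (E : Fin n → Set ℝ) : Continuous (boxTransform A w E) := by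
  refine continuous_of_dominated (bound := fun x => ‖complexDensity A w 0 x‖)
    (fun η => (integrable_complexDensity A hw η).integrableOn.aestronglyMeasurable)
    (fun η => Filter.Eventually.of_forall fun x => (norm_complexDensity A w η x).le)
    (integrable_complexDensity A hw 0).integrableOn.norm (Filter.Eventually.of_forall fun x => ?_)
  rw [funext fun η => complexDensity_eq_mul A w η x]
  fun_prop

theorem integrable_boxTransform {A : Matrix (Fin m) (Fin n) ℝ} (hrank : A.rank = m)
    (hcol : ∀ j : Fin n,
      (A.submatrix id (Subtype.val : {k : Fin n // k ≠ j} → Fin n)).rank = A.rank)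
    {w : Fin n → ℝ} (hw : ∀ j, 0 < w j) {E : Fin n → Set ℝ} (hE : ∀ j, (E j).OrdConnected) :
    Integrable (boxTransform A w E) :=
  ((integrable_prod_norm_rate_inv A hrank hcol hw).const_mul (2 ^ n)).mono'
    (continuous_boxTransform A hw E).aestronglyMeasurable
    (Filter.Eventually.of_forall fun η => norm_setIntegral_box_complexDensity_le A hw η hE)

/-- The density cut off to a box is continuous at points none of whose coordinates lies in the
frontier of the corresponding side. -/
theorem continuousAt_indicator_box_complexDensity (A : Matrix (Fin m) (Fin n) ℝ) (w : Fin n → ℝ)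
    (η : EuclideanSpace ℝ (Fin m)) {E : Fin n → Set ℝ} {x : EuclideanSpace ℝ (Fin n)}
    (hx : ∀ j, x j ∉ frontier (E j ∩ Set.Ici 0)) :
    ContinuousAt ((box E).indicator (complexDensity A w η)) x := by
  have h : (box E).indicator (complexDensity A w η) = fun x => ∏ j,
      (E j ∩ Set.Ici 0).indicator (fun t : ℝ => Complex.exp (-rate A w η j * t)) (x j) := by
    ext x
    simp_rw [funext (complexDensity_eq_prod A w η), indicator_box_prod, Set.indicator_indicator]
  rw [h]
  refine tendsto_finsetProd _ fun j _ => ?_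
  have hc : ContinuousAt ((E j ∩ Set.Ici 0).indicator
      fun t : ℝ => Complex.exp (-rate A w η j * t)) (x j) :=
    ContinuousOn.continuousAt_indicator (Continuous.continuousOn (by fun_prop)) (hx j)
  exact ContinuousAt.comp (f := fun x : EuclideanSpace ℝ (Fin n) => x j) hc (by fun_prop)

theorem complexDensity_zero_of_mem_orthant {A : Matrix (Fin m) (Fin n) ℝ} {w : Fin n → ℝ}
    {l : EuclideanSpace ℝ (Fin m)} (hl : ∀ j, innerCol A l j = w j)
    {x : EuclideanSpace ℝ (Fin n)} (hx : x ∈ orthant n) :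
    complexDensity A w 0 x = (Real.exp (-∑ i, l i * euclMap A x i) : ℂ) := by
  rw [complexDensity, Set.indicator_of_mem hx, Complex.ofReal_exp, ← sum_innerCol_mul]
  push_cast
  congr 2
  refine Finset.sum_congr rfl fun j _ => ?_
  rw [hl]
  simp [innerCol]

/-- On a fiber the right-hand sum is fixed when `w` is in the row span, so this bounds nearby fibers
uniformly. -/
theorem norm_le_of_mem_orthant {w : Fin n → ℝ} (hw : ∀ j, 0 < w j) {x : EuclideanSpace ℝ (Fin n)}
    (hx : x ∈ orthant n) : ‖x‖ ≤ (∑ j, (w j)⁻¹) * ∑ j, w j * x j := by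
  have h1 : ∀ j, x j ≤ (w j)⁻¹ * ∑ k, w k * x k := fun j => by
    rw [le_inv_mul_iff₀ (hw j)]
    exact Finset.single_le_sum (f := fun k => w k * x k)
      (fun k _ => mul_nonneg (hw k).le (hx k)) (Finset.mem_univ j)
  calc ‖x‖ ≤ ∑ j, ‖x j‖ := by
        conv_lhs => rw [← (EuclideanSpace.basisFun (Fin n) ℝ).sum_repr x]
        refine (norm_sum_le _ _).trans (Finset.sum_le_sum fun j _ => ?_)
        simp [norm_smul]
    _ = ∑ j, x j := Finset.sum_congr rfl fun j _ => Real.norm_of_nonneg (hx j)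
    _ ≤ _ := by
        rw [Finset.sum_mul]
        exact Finset.sum_le_sum fun j _ => h1 j

/-- The fiber integral, over the points of the fiber `L y + ker A` in a box, of the exponential
density. -/
def fiberIntegral (A : Matrix (Fin m) (Fin n) ℝ) (w : Fin n → ℝ)
    (L : EuclideanSpace ℝ (Fin m) →ₗ[ℝ] EuclideanSpace ℝ (Fin n))
    (ν : Measure (LinearMap.ker (euclMap A))) (E : Fin n → Set ℝ)
    (y : EuclideanSpace ℝ (Fin m)) : ℂ :=
  ∫ v : LinearMap.ker (euclMap A), (box E).indicator (complexDensity A w 0) (L y + v) ∂ν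

variable {A : Matrix (Fin m) (Fin n) ℝ} {w : Fin n → ℝ}
  {L : EuclideanSpace ℝ (Fin m) →ₗ[ℝ] EuclideanSpace ℝ (Fin n)}

theorem measurable_complexDensity (η : EuclideanSpace ℝ (Fin m)) :
    Measurable (complexDensity A w η) :=
  Measurable.indicator (by fun_prop) measurableSet_orthant

theorem continuousAt_fiberIntegral (hrank : A.rank = m)
    (hcol : ∀ j : Fin n,
      (A.submatrix id (Subtype.val : {k : Fin n // k ≠ j} → Fin n)).rank = A.rank)
    (hw : ∀ j, 0 < w j) {l : EuclideanSpace ℝ (Fin m)} (hl : ∀ j, innerCol A l j = w j)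
    (hL : ∀ y, euclMap A (L y) = y) (ν : Measure (LinearMap.ker (euclMap A))) [ν.IsAddHaarMeasure]
    {E : Fin n → Set ℝ} (hE : ∀ j, (E j).OrdConnected) (y₀ : EuclideanSpace ℝ (Fin m)) :
    ContinuousAt (fiberIntegral A w L ν E) y₀ := by
  have hLc : Continuous L := L.continuous_of_finiteDimensional
  have hmeas : Measurable ((box E).indicator (complexDensity A w 0)) :=
    (measurable_complexDensity 0).indicator (measurableSet_box fun j => (hE j).measurableSet)
  have hP : ∀ y, ∀ v : LinearMap.ker (euclMap A), euclMap A (L y + v) = y := fun y v => by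
    rw [map_add, hL, LinearMap.mem_ker.1 v.2, add_zero]
  set M : ℝ := ∑ i, l i * y₀ i + 1 with hM
  -- `R` bounds `‖v‖ ≤ ‖L y + v‖ + ‖L y‖` for orthant points `L y + v` with `y` near `y₀`.
  set R : ℝ := (∑ j, (w j)⁻¹) * M + (‖L y₀‖ + 1) with hR
  have hnear : ∀ᶠ y in nhds y₀, ∑ i, l i * y i < M ∧ ‖L y‖ < ‖L y₀‖ + 1 := by
    refine Filter.Eventually.and ?_ ?_
    · have : ContinuousAt (fun y : EuclideanSpace ℝ (Fin m) => ∑ i, l i * y i) y₀ := by fun_prop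
      exact this.eventually_lt_const (lt_add_one _)
    · exact (hLc.norm.continuousAt (x := y₀)).eventually_lt_const (lt_add_one _)
  refine continuousAt_of_dominated
    (bound := (Metric.closedBall 0 R).indicator fun _ => Real.exp (|∑ i, l i * y₀ i| + 1)) ?_ ?_ ?_ ?_
  · exact Filter.Eventually.of_forall fun y => (hmeas.comp (by fun_prop)).aestronglyMeasurable
  · have hnear' : ∀ᶠ y in nhds y₀, -(∑ i, l i * y i) < |∑ i, l i * y₀ i| + 1 := by
      have : ContinuousAt (fun y : EuclideanSpace ℝ (Fin m) => -∑ i, l i * y i) y₀ := by fun_prop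
      refine this.eventually_lt_const ?_
      linarith [neg_le_abs (∑ i, l i * y₀ i)]
    filter_upwards [hnear, hnear'] with y hy hy'
    refine Filter.Eventually.of_forall fun v => ?_
    by_cases hx : L y + v ∈ orthant n
    · have hvR : v ∈ Metric.closedBall (0 : LinearMap.ker (euclMap A)) R := by
        have hsum : ∑ j, w j * (L y + (v : EuclideanSpace ℝ (Fin n))) j ≤ M := by
          simp_rw [← hl]
          rw [sum_innerCol_mul, hP]
          exact hy.1.le
        have h1 := (norm_le_of_mem_orthant hw hx).trans (mul_le_mul_of_nonneg_left hsum
          (Finset.sum_nonneg fun j _ => (inv_pos.2 (hw j)).le))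
        have h2 : ‖(v : EuclideanSpace ℝ (Fin n))‖ ≤ ‖L y + (v : EuclideanSpace ℝ (Fin n))‖ + ‖L y‖ := by
          simpa using norm_sub_le (L y + (v : EuclideanSpace ℝ (Fin n))) (L y)
        rw [mem_closedBall_zero_iff, Submodule.coe_norm]
        linarith [hy.2]
      rw [Set.indicator_of_mem hvR]
      refine (norm_indicator_le_norm_self _ _).trans ?_
      rw [complexDensity_zero_of_mem_orthant hl hx, hP, Complex.norm_real,
        Real.norm_of_nonneg (Real.exp_nonneg _)]
      exact Real.exp_le_exp.2 hy'.le
    · have h0 : complexDensity A w 0 (L y + v) = 0 := Set.indicator_of_notMem hx _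
      rw [Set.indicator_apply_eq_zero.2 fun _ => h0, norm_zero]
      exact Set.indicator_nonneg (fun _ _ => Real.exp_nonneg _) _
  · rw [integrable_indicator_iff measurableSet_closedBall]
    exact integrableOn_const (isCompact_closedBall _ _).measure_ne_top
  · have hnull : ∀ᵐ v : LinearMap.ker (euclMap A) ∂ν, ∀ j, (L y₀ + (v : EuclideanSpace ℝ (Fin n))) j ∉
        frontier (E j ∩ Set.Ici 0) := by
      refine ae_all_iff.2 fun j => ?_
      rw [ae_iff]
      simp only [not_not]
      exact measure_frontier_coord hrank j (hcol j) (L y₀) ((hE j).inter Set.ordConnected_Ici) ν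
    filter_upwards [hnull] with v hv
    have h := continuousAt_indicator_box_complexDensity A w 0 hv
    exact ContinuousAt.comp (f := fun y => L y + (v : EuclideanSpace ℝ (Fin n))) h (by fun_prop)

theorem fiberIntegral_eq {l : EuclideanSpace ℝ (Fin m)} (hl : ∀ j, innerCol A l j = w j)
    (hL : ∀ y, euclMap A (L y) = y) (ν : Measure (LinearMap.ker (euclMap A)))
    {E : Fin n → Set ℝ} (hE : ∀ j, MeasurableSet (E j)) (y : EuclideanSpace ℝ (Fin m)) :
    fiberIntegral A w L ν E y =
      (Real.exp (-∑ i, l i * y i) : ℂ) * (ν.real (fiberSet A (L y) E) : ℂ) := by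
  have hms : MeasurableSet (fiberSet A (L y) E) :=
    ((measurableSet_box hE).inter measurableSet_orthant).preimage
      (by fun_prop : Measurable fun v : LinearMap.ker (euclMap A) =>
        L y + (v : EuclideanSpace ℝ (Fin n)))
  have h : ∀ v : LinearMap.ker (euclMap A),
      (box E).indicator (complexDensity A w 0) (L y + v) =
        (fiberSet A (L y) E).indicator (fun _ => (Real.exp (-∑ i, l i * y i) : ℂ)) v := fun v => by
    by_cases hv : v ∈ fiberSet A (L y) E
    · rw [Set.indicator_of_mem hv, Set.indicator_of_mem hv.1,
        complexDensity_zero_of_mem_orthant hl hv.2, map_add, hL, LinearMap.mem_ker.1 v.2, add_zero]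
    · rw [Set.indicator_of_notMem hv, complexDensity, Set.indicator_indicator]
      exact Set.indicator_of_notMem (s := box E ∩ orthant n) hv _
  simp_rw [fiberIntegral, h, integral_indicator hms, setIntegral_const, Complex.real_smul]
  rw [mul_comm]

-- The order of quantifiers matters: `C` serves all boxes, so it disappears from the ratio with the
-- full box.
open FourierTransform in
theorem integral_exp_mul_boxTransform (hrank : A.rank = m)
    (hcol : ∀ j : Fin n,
      (A.submatrix id (Subtype.val : {k : Fin n // k ≠ j} → Fin n)).rank = A.rank)
    (hw : ∀ j, 0 < w j) {l : EuclideanSpace ℝ (Fin m)} (hl : ∀ j, innerCol A l j = w j)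
    (hL : ∀ y, euclMap A (L y) = y) (ν : Measure (LinearMap.ker (euclMap A))) [ν.IsAddHaarMeasure]
    (y₀ : EuclideanSpace ℝ (Fin m)) :
    ∃ C : ℂ, C ≠ 0 ∧ ∀ E : Fin n → Set ℝ, (∀ j, (E j).OrdConnected) →
      ∫ η, Complex.exp (-(Complex.I * ∑ i, (η i : ℂ) * (y₀ i : ℂ))) * boxTransform A w E η =
        C * (ν.real (fiberSet A (L y₀) E) : ℂ) := by
  obtain ⟨c, hc, hfib⟩ := exists_integral_fiber (euclMap A) L hL volume volume ν
  have hc0 : (c : ℂ) ≠ 0 := Complex.ofReal_ne_zero.2 hc.ne'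
  -- Jacobian of the substitution `η = -2π ξ`, which turns the kernel `exp(-2πi⟨y, ξ⟩)` of `𝓕` into
  -- `exp(i⟨y, η⟩)`.
  set r : ℝ := |((-2 * Real.pi) ^ Module.finrank ℝ (EuclideanSpace ℝ (Fin m)))⁻¹| with hr
  have hr0 : (r : ℂ) ≠ 0 := by
    rw [Complex.ofReal_ne_zero, hr, abs_ne_zero]
    exact inv_ne_zero (pow_ne_zero _ (by simp [Real.pi_ne_zero]))
  refine ⟨(r : ℂ)⁻¹ * c * Real.exp (-∑ i, l i * y₀ i), by
    refine mul_ne_zero (mul_ne_zero (inv_ne_zero hr0) hc0) ?_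
    exact Complex.ofReal_ne_zero.2 (Real.exp_ne_zero _), fun E hE => ?_⟩
  have hEm : ∀ j, MeasurableSet (E j) := fun j => (hE j).measurableSet
  have hbox := measurableSet_box hEm
  have hint : ∀ η, Integrable ((box E).indicator (complexDensity A w η)) := fun η =>
    (integrable_complexDensity A hw η).indicator hbox
  have hg : Integrable (fiberIntegral A w L ν E) := (hfib _ (hint 0)).1.integral_prod_left
  have hfourier : ∀ ξ, 𝓕 (fiberIntegral A w L ν E) ξ =
      (c : ℂ)⁻¹ * boxTransform A w E ((-2 * Real.pi) • ξ) := fun ξ => by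
    rw [boxTransform, ← integral_indicator hbox, (hfib _ (hint _)).2, inv_mul_cancel_left₀ hc0,
      Real.fourier_eq']
    refine integral_congr_ae (Filter.Eventually.of_forall fun y => ?_)
    dsimp only
    rw [fiberIntegral, smul_eq_mul, ← integral_const_mul]
    refine integral_congr_ae (Filter.Eventually.of_forall fun v => ?_)
    dsimp only
    by_cases hv : L y + (v : EuclideanSpace ℝ (Fin n)) ∈ box E
    · rw [Set.indicator_of_mem hv, Set.indicator_of_mem hv, complexDensity_eq_mul A w ((-2 * _) • ξ),
        map_add, hL, LinearMap.mem_ker.1 v.2, add_zero, real_inner_smul_right]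
    · rw [Set.indicator_of_notMem hv, Set.indicator_of_notMem hv, mul_zero]
  have hfi : Integrable (𝓕 (fiberIntegral A w L ν E)) := by
    rw [funext hfourier]
    exact ((integrable_boxTransform hrank hcol hw hE).comp_smul
      (by simp [Real.pi_ne_zero])).const_mul _
  have hinv := hg.fourierInv_fourier_eq hfi
    (continuousAt_fiberIntegral hrank hcol hw hl hL ν hE y₀)
  rw [fiberIntegral_eq hl hL ν hEm, Real.fourierInv_eq'] at hinv
  simp_rw [hfourier] at hinv
  have hcs := Measure.integral_comp_smul (volume : Measure (EuclideanSpace ℝ (Fin m))) (fun η =>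
    Complex.exp (-(Complex.I * ∑ i, (η i : ℂ) * (y₀ i : ℂ))) * boxTransform A w E η) (-2 * Real.pi)
  rw [← hr, Complex.real_smul] at hcs
  have hinv' : ∫ ξ : EuclideanSpace ℝ (Fin m), Complex.exp ((↑(2 * Real.pi * inner ℝ ξ y₀) *
      Complex.I)) • ((c : ℂ)⁻¹ * boxTransform A w E ((-2 * Real.pi) • ξ)) =
      (c : ℂ)⁻¹ * ∫ ξ : EuclideanSpace ℝ (Fin m), Complex.exp (-(Complex.I *
        ∑ i, ((((-2 * Real.pi) • ξ) i : ℝ) : ℂ) * (y₀ i : ℂ))) *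
          boxTransform A w E ((-2 * Real.pi) • ξ) := by
    rw [← integral_const_mul]
    refine integral_congr_ae (Filter.Eventually.of_forall fun ξ => ?_)
    have he : ((2 * Real.pi * inner ℝ ξ y₀ : ℝ) : ℂ) * Complex.I =
        -(Complex.I * ∑ i, ((((-2 * Real.pi) • ξ) i : ℝ) : ℂ) * (y₀ i : ℂ)) := by
      simp only [PiLp.inner_apply, PiLp.smul_apply, smul_eq_mul, RCLike.inner_apply, conj_trivial]
      push_cast
      simp only [Finset.mul_sum, Finset.sum_mul, ← Finset.sum_neg_distrib]
      exact Finset.sum_congr rfl fun i _ => by ring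
    dsimp only
    rw [he, smul_eq_mul]
    ring
  rw [hinv', hcs, ← mul_assoc] at hinv
  field_simp at hinv ⊢
  linear_combination hinv

end Inversion

/-! ### The normalized measures and their product -/

section Mixture

theorem boxTransform_univ (A : Matrix (Fin m) (Fin n) ℝ) (w : Fin n → ℝ)
    (η : EuclideanSpace ℝ (Fin m)) : boxTransform A w (fun _ => Set.univ) η = complexZ A w η := by
  rw [boxTransform, box_univ, setIntegral_univ, complexZ]

theorem complexProduct_box (A : Matrix (Fin m) (Fin n) ℝ) {w : Fin n → ℝ} (hw : ∀ j, 0 < w j)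
    (η : EuclideanSpace ℝ (Fin m)) {E : Fin n → Set ℝ} (hE : ∀ j, MeasurableSet (E j)) :
    complexProduct A w η (box E) = (complexZ A w η)⁻¹ * boxTransform A w E η := by
  rw [complexProduct, _root_.smul_apply, withDensityᵥ_apply
    (integrable_complexDensity A hw η) (measurableSet_box hE), smul_eq_mul, boxTransform]

/-- The box mass and `complexZ` decay alike in `η`, so the quotient is bounded and hence integrable
for the mixing measure. -/
theorem norm_complexProduct_box_le (A : Matrix (Fin m) (Fin n) ℝ) {w : Fin n → ℝ}
    (hw : ∀ j, 0 < w j) (η : EuclideanSpace ℝ (Fin m)) {E : Fin n → Set ℝ}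
    (hE : ∀ j, (E j).OrdConnected) : ‖complexProduct A w η (box E)‖ ≤ 2 ^ n := by
  rw [complexProduct_box A hw η fun j => (hE j).measurableSet, norm_mul, norm_inv,
    inv_mul_le_iff₀ (norm_pos_iff.2 (complexZ_ne_zero A hw η)), mul_comm]
  refine (norm_setIntegral_box_complexDensity_le A hw η hE).trans_eq ?_
  rw [complexZ_eq_prod A hw, norm_prod]
  simp_rw [norm_inv]

theorem measurable_complexProduct_box (A : Matrix (Fin m) (Fin n) ℝ) {w : Fin n → ℝ}
    (hw : ∀ j, 0 < w j) {E : Fin n → Set ℝ} (hE : ∀ j, MeasurableSet (E j)) :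
    Measurable fun η => complexProduct A w η (box E) := by
  simp_rw [complexProduct_box A hw _ hE, ← boxTransform_univ]
  exact (continuous_boxTransform A hw _).measurable.inv.mul
    (continuous_boxTransform A hw E).measurable

theorem integrable_mixDensity {A : Matrix (Fin m) (Fin n) ℝ} (b : Fin m → ℝ) (hrank : A.rank = m)
    (hcol : ∀ j : Fin n,
      (A.submatrix id (Subtype.val : {k : Fin n // k ≠ j} → Fin n)).rank = A.rank)
    {w : Fin n → ℝ} (hw : ∀ j, 0 < w j) : Integrable (mixDensity A b w) := by
  have hZ : Integrable (complexZ A w) := by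
    rw [← funext (boxTransform_univ A w)]
    exact integrable_boxTransform hrank hcol hw fun _ => Set.ordConnected_univ
  rw [funext (mixDensity_eq A b hw)]
  refine hZ.bdd_mul (c := ‖∏ j, (w j : ℂ)‖) (Continuous.aestronglyMeasurable (by fun_prop))
    (Filter.Eventually.of_forall fun η => ?_)
  have : Complex.exp (-(Complex.I * ∑ l, (η l : ℂ) * (b l : ℂ))) =
      Complex.exp ((-∑ l, η l * b l : ℝ) * Complex.I) := by
    congr 1
    push_cast
    ring
  rw [norm_mul, this, Complex.norm_exp_ofReal_mul_I, mul_one]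

theorem complexProduct_box_mul_mixDensity (A : Matrix (Fin m) (Fin n) ℝ) (b : Fin m → ℝ)
    {w : Fin n → ℝ} (hw : ∀ j, 0 < w j) (η : EuclideanSpace ℝ (Fin m)) {E : Fin n → Set ℝ}
    (hE : ∀ j, MeasurableSet (E j)) :
    complexProduct A w η (box E) * mixDensity A b w η = (∏ j, (w j : ℂ)) *
      (Complex.exp (-(Complex.I * ∑ l, (η l : ℂ) * (b l : ℂ))) * boxTransform A w E η) := by
  have := complexZ_ne_zero A hw η
  rw [complexProduct_box A hw η hE, mixDensity_eq A b hw]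
  field_simp

end Mixture

end Polytope

end

/-! ### The mixture formula -/

open Polytope in
theorem theorem2p4 {m n : ℕ} (A : Matrix (Fin m) (Fin n) ℝ) (b : Fin m → ℝ)
    (hrank : A.rank = m)
    (hcompact : IsCompact (Polytope.polytope A b))
    (hint : ∃ x ∈ Polytope.polytope A b, ∀ j, 0 < x j)
    (hcol : ∀ j : Fin n,
      (A.submatrix id (Subtype.val : {k : Fin n // k ≠ j} → Fin n)).rank = A.rank)
    (w : Fin n → ℝ) (hw : ∀ j, 0 < w j)
    (hwA : Polytope.IsMaxEntropy A b w ∨ w ∈ Submodule.span ℝ (Set.range A.row)) :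
    (∀ η : EuclideanSpace ℝ (Fin m),
      MeasureTheory.Integrable (Polytope.complexDensity A w η) ∧ Polytope.complexZ A w η ≠ 0) ∧
    MeasureTheory.Integrable (Polytope.mixDensity A b w) ∧
    Polytope.mixZ A b w ≠ 0 ∧
    ∀ E : Fin n → Set ℝ, (∀ j, (E j).OrdConnected) →
      (Polytope.mixMeasure A b w).Integrable
        (fun η => Polytope.complexProduct A w η (Polytope.box E)) ∧
      (((Polytope.uniform A b).real (Polytope.box E) : ℝ) : ℂ) =
        (Polytope.mixMeasure A b w).integral
          (fun η => Polytope.complexProduct A w η (Polytope.box E))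
          (ContinuousLinearMap.mul ℝ ℂ) := by
  obtain ⟨l, hl⟩ := mem_span_row_iff.1 (hwA.elim (fun h => h.mem_span_row hw) id)
  obtain ⟨L, hL'⟩ := (euclMap A).exists_rightInverse_of_surjective
    (LinearMap.range_eq_top.2 (euclMap_surjective hrank))
  have hL : ∀ y, euclMap A (L y) = y := fun y => LinearMap.congr_fun hL' y
  -- In full dimension, Hausdorff measure on the kernel is a Haar measure; translation carries it
  -- isometrically to the fiber over `b`.
  set ν : Measure (LinearMap.ker (euclMap A)) :=
    Measure.hausdorffMeasure (Module.finrank ℝ (LinearMap.ker (euclMap A))) with hν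
  have hνpos := measure_fiberSet_univ (hL (WithLp.toLp 2 b)) hcompact hint ν
  have hν0 : (ν.real (fiberSet A (L (WithLp.toLp 2 b)) fun _ => Set.univ) : ℂ) ≠ 0 :=
    Complex.ofReal_ne_zero.2 hνpos.ne'
  obtain ⟨C, hC, hCE⟩ := integral_exp_mul_boxTransform hrank hcol hw hl hL ν (WithLp.toLp 2 b)
  have hw0 : ∏ j, (w j : ℂ) ≠ 0 :=
    Finset.prod_ne_zero_iff.2 fun j _ => Complex.ofReal_ne_zero.2 (hw j).ne'
  have hmixint := integrable_mixDensity b hrank hcol hw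
  have hmix : mixZ A b w = (∏ j, (w j : ℂ)) *
      (C * (ν.real (fiberSet A (L (WithLp.toLp 2 b)) fun _ => Set.univ) : ℂ)) := by
    rw [← hCE _ fun _ => Set.ordConnected_univ, ← integral_const_mul, mixZ]
    simp_rw [mixDensity_eq A b hw, boxTransform_univ, mul_assoc]
  refine ⟨fun η => ⟨integrable_complexDensity A hw η, complexZ_ne_zero A hw η⟩, hmixint, ?_,
    fun E hE => ?_⟩
  · rw [hmix]
    exact mul_ne_zero hw0 (mul_ne_zero hC hν0)
  · have hEm : ∀ j, MeasurableSet (E j) := fun j => (hE j).measurableSet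
    obtain ⟨h1, h2⟩ := integrable_and_integral_withDensityᵥ_of_bounded
      (hmixint.smul (mixZ A b w)⁻¹) (measurable_complexProduct_box A hw hEm)
      fun η => norm_complexProduct_box_le A hw η hE
    rw [withDensityᵥ_smul] at h1 h2
    refine ⟨h1, ?_⟩
    rw [mixMeasure, h2, uniform_real_box hrank (hL (WithLp.toLp 2 b)) hEm hν]
    have h3 : ∀ η, complexProduct A w η (box E) * ((mixZ A b w)⁻¹ • mixDensity A b w) η =
        (mixZ A b w)⁻¹ * (∏ j, (w j : ℂ)) * (Complex.exp (-(Complex.I *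
          ∑ l, (η l : ℂ) * ((WithLp.toLp 2 b : EuclideanSpace ℝ (Fin m)) l : ℂ))) *
            boxTransform A w E η) := fun η => by
      rw [mul_assoc, ← complexProduct_box_mul_mixDensity A b hw η hEm, Pi.smul_apply, smul_eq_mul]
      ring
    simp_rw [h3]
    rw [integral_const_mul, hCE E hE, hmix]
    push_cast
    field_simp
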